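/- Let $M>0$ and let $\pi_\star$ be a probability measure on $[-M,M]$. For each $n\ge 1$ let $$X_i=\theta_i+\varepsilon_i,\qquad i=1,\dots,n,$$ where $\theta_1,\dots,\theta_n$ are i.i.d. with law $\pi_\star$, the vector $(\varepsilon_1,\dots,\varepsilon_n)\sim N(0,\Sigma_n)$ is independent of $(\theta_1,\dots,\theta_n)$, $\Sigma_n$ is positive semidefinite, and $(\Sigma_n)_{ii}=\sigma_i^2$ with $\sigma_i>0$ (all quantities may depend on $n$). Write $\phi(x;\sigma)$ for the density of $N(0,\sigma^2)$, $f_{\pi,\sigma}(x)=\int\phi(x-\theta;\sigma)\,d\pi(\theta)$, $h_\pi(x;\sigma)=\int\theta\,\phi(x-\theta;\sigma)\,d\pi(\theta)/f_{\pi,\sigma}(x)$, and $\mathrm{Hel}^2(p,q)=\frac12\int(\sqrt p-\sqrt q)^2\,dx$. Let $\hat\pi_n$ be a random probability measure on $\mathbb R$ with $\hat\pi_n([-M,M])=1$ almost surely, and let $\hat\sigma_1,\dots,\hat\sigma_n$ be random variables on the same probability space (for example, functions of $X_1,\dots,X_n$), such that: (i) there are constants $c,C>0$, not depending on $n$, with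 $c\le\sigma_i\le C$ and $c\le\hat\sigma_i\le C$ almost surely for all $i\le n$; (ii) there is a deterministic sequence $r_n\to0$ with, almost surely, $$\frac1n\sum_{i=1}^n\log f_{\hat\pi_n,\hat\sigma_i}(X_i)\ \ge\ \frac1n\sum_{i=1}^n\log f_{\pi_\star,\hat\sigma_i}(X_i)-r_n;$$ (iii) $\frac1n\sum_{i=1}^n|\hat\sigma_i-\sigma_i|\to0$ in probability. Suppose that $\|\Sigma_n\|_{\mathrm{op}}=o(n)$. Then, as $n\to\infty$: (a) $\hat\pi_n$ converges weakly to $\pi_\star$ in probability, i.e. $\mathbb P(\hat\pi_n\notin U)\to0$ for every neighbourhood $U$ of $\pi_\star$ in the topology of weak convergence of probability measures; (b) $\frac1n\sum_{i=1}^n\mathrm{Hel}^2\bigl(f_{\hat\pi_n,\sigma_i},f_{\pi_\star,\sigma_i}\bigr)\to0$ in probability; (c) with $\hat\theta_i=h_{\hat\pi_n}(X_i;\hat\sigma_i)$, the regret $$\sqrt{\frac1n\sum_{i=1}^n\mathbb E\bigl|\theta_i-\hat\theta_i\bigr|^2}-\sqrt{\frac1n\sum_{i=1}^n\mathbb E\bigl|\theta_i-\mathbb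 E_{\pi_\star}[\theta_i\mid Z_i]\bigr|^2}$$ converges to $0$, where in the second term $\theta_i\sim\pi_\star$ and $Z_i=\theta_i+\zeta_i$ with $\zeta_i\sim N(0,\sigma_i^2)$ independent of $\theta_i$. -/

import Mathlib

open MeasureTheory ProbabilityTheory Filter Topology

noncomputable section

namespace NormalEB

/-- The class of probability measures on the real line that are supported on `[-M, M]`. -/
def SupportedIn (M : ℝ) (π : ProbabilityMeasure ℝ) : Prop :=
  (π : Measure ℝ) (Set.Icc (-M) M) = 1

/-- The density `φ(x; σ)` of the normal law `N(0, σ²)`. -/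
def normalDensity (x σ : ℝ) : ℝ :=
  gaussianPDFReal 0 (Real.toNNReal (σ ^ 2)) x

/-- The normal mixture density `f_{π,σ}(x) = ∫ φ(x - t; σ) dπ(t)`. -/
def mixDensity (π : ProbabilityMeasure ℝ) (σ x : ℝ) : ℝ :=
  ∫ t, normalDensity (x - t) σ ∂(π : Measure ℝ)

/-- The squared Hellinger distance `½ ∫ (√p - √q)²` between two densities on the real line. -/
def hellingerSq (p q : ℝ → ℝ) : ℝ :=
  (1 / 2) * ∫ x, (√(p x) - √(q x)) ^ 2

/-- The normal posterior mean `h_π(x; σ) = ∫ t φ(x - t; σ) dπ(t) / f_{π,σ}(x)`. -/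
def postMean (π : ProbabilityMeasure ℝ) (x σ : ℝ) : ℝ :=
  (∫ t, t * normalDensity (x - t) σ ∂(π : Measure ℝ)) / mixDensity π σ x

/-- The joint law of `(θ, ζ)` with independent `θ ∼ π` and `ζ ∼ N(0, σ²)`; the normal experiment
observes `Z = θ + ζ`. -/
def normalExperiment (π : ProbabilityMeasure ℝ) (σ : ℝ) : Measure (ℝ × ℝ) :=
  (π : Measure ℝ).prod (gaussianReal 0 (Real.toNNReal (σ ^ 2)))

/-- The conditional expectation `E_π[θ ∣ Z]` in the normal experiment. -/
def oraclePostMean (π : ProbabilityMeasure ℝ) (σ : ℝ) : ℝ × ℝ → ℝ :=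
  (normalExperiment π σ)[(fun p : ℝ × ℝ => p.1) |
    MeasurableSpace.comap (fun p : ℝ × ℝ => p.1 + p.2) inferInstance]

/-- The mean squared error `E |θ - E_π[θ ∣ Z]|²` of the normal oracle. -/
def oracleRisk (π : ProbabilityMeasure ℝ) (σ : ℝ) : ℝ :=
  ∫ p, (p.1 - oraclePostMean π σ p) ^ 2 ∂(normalExperiment π σ)

/-- The average `n⁻¹ ∑ᵢ aᵢ`. -/
def avg {n : ℕ} (a : Fin n → ℝ) : ℝ := (1 / (n : ℝ)) * ∑ i, a i

/-- The regret, against the normal oracle, of the plug-in rule `θ̂ᵢ = h_{π̂}(Xᵢ; σ̂ᵢ)`. -/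
def regret {n : ℕ} {Ω : Type*} [MeasurableSpace Ω] (P : Measure Ω)
    (πstar : ProbabilityMeasure ℝ) (σ : Fin n → ℝ) (θ X : Fin n → Ω → ℝ)
    (πhat : Ω → ProbabilityMeasure ℝ) (σhat : Fin n → Ω → ℝ) : ℝ :=
  √(avg fun i => ∫ ω, (θ i ω - postMean (πhat ω) (X i ω) (σhat i ω)) ^ 2 ∂P)
    - √(avg fun i => oracleRisk πstar (σ i))

/-- Convergence in probability to a constant `a`, in a topological space `E`, of `E`-valued
random elements `Y n`, each defined on its own probability space: the probability of lying
outside any given neighbourhood of `a` tends to zero. -/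
def TendstoInProb {E : Type*} [TopologicalSpace E] {Ω : ℕ → Type*}
    [∀ n, MeasurableSpace (Ω n)] (P : ∀ n, Measure (Ω n)) (Y : ∀ n, Ω n → E) (a : E) : Prop :=
  ∀ U ∈ 𝓝 a, Tendsto (fun n => P n {ω | Y n ω ∉ U}) atTop (𝓝 0)

/-- Approximate optimality with estimated variances: `σᵢ` and `σ̂ᵢ` lie between fixed positive
constants, `π̂ₙ` is supported in `[-M, M]`, the plug-in marginal log-likelihood of `π̂ₙ` is within
a deterministic `rₙ → 0` of that of `πstar` (all almost surely), and the `σ̂ᵢ` are consistent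
for the `σᵢ` on average. -/
structure ApproxOptimal {Ω : ℕ → Type*} [∀ n, MeasurableSpace (Ω n)]
    (P : ∀ n, Measure (Ω n)) (M : ℝ) (πstar : ProbabilityMeasure ℝ)
    (σ : ∀ n, Fin n → ℝ) (X : ∀ n, Fin n → Ω n → ℝ)
    (πhat : ∀ n, Ω n → ProbabilityMeasure ℝ) (σhat : ∀ n, Fin n → Ω n → ℝ) : Prop where
  bounds : ∃ c C : ℝ, 0 < c ∧ 0 < C ∧
    ∀ n, ∀ i, (c ≤ σ n i ∧ σ n i ≤ C) ∧ ∀ᵐ ω ∂(P n), c ≤ σhat n i ω ∧ σhat n i ω ≤ C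
  supported : ∀ n, ∀ᵐ ω ∂(P n), SupportedIn M (πhat n ω)
  likelihood : ∃ r : ℕ → ℝ, Tendsto r atTop (𝓝 0) ∧ ∀ n, ∀ᵐ ω ∂(P n),
    avg (fun i => Real.log (mixDensity (πhat n ω) (σhat n i ω) (X n i ω)))
      ≥ avg (fun i => Real.log (mixDensity πstar (σhat n i ω) (X n i ω))) - r n
  variances : TendstoInProb P (fun n ω => avg fun i => |σhat n i ω - σ n i|) 0

end NormalEB

end

namespace NormalEB

/-! ### Weak convergence and parametric integrals -/

/-! The argument is Wald's consistency proof, run on the empirical law of the pairs `(Xᵢ, σ̂ᵢ)`.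
Mixing laws live on `[-M, M]`, so they form a compact space, and with the factor `φ(x; s)` cancelled
the log-likelihood ratio of two of them is jointly continuous and grows at most linearly in `x`.

Correlation enters only through a law of large numbers for characters. For `i ≠ j` the covariance of
`e^{itXᵢ}` and `e^{itXⱼ}` is at most `t² |Σᵢⱼ|` (`norm_cov_cexp_le`). Cauchy–Schwarz and `‖Σ‖²_HS ≤
‖Σ‖_op tr Σ` bound `∑ |Σᵢⱼ|` by `n² C √(‖Σ‖_op / n)`, which is `o(n²)` exactly because `‖Σ‖_op =
o(n)`. Averages of centred characters therefore vanish in mean square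
(`integral_norm_sq_average_le`). Since `σ̂ᵢ` is close to `σᵢ` on average, every limit point of the
empirical law is the law of `(θ + s ζ, s)` with `s ∼ Q`, where `Q` is a limit point of the empirical
law of the `σᵢ`.

Bounded second moments let the likelihood inequality pass to the limit. A limit point `μ₁` of the
estimators then has nonnegative expected log-likelihood ratio against the truth. At every noise
level this expectation is minus a Kullback–Leibler divergence, strictly negative unless `μ₁` is the
true law (`integral_logRatio_neg`); hence consistency (`tendsto_of_likelihood`).

Convergence in probability is convergence along the filter of events whose probability tends to one,
so the compactness argument is run deterministically along each finer ultrafilter. The Hellinger and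
regret claims follow from consistency by continuity, uniformly over compact sets of noise levels and
observations. -/

theorem continuous_integral_param {A K : Type*} [TopologicalSpace A] [TopologicalSpace K]
    [CompactSpace K] [MeasurableSpace K] [OpensMeasurableSpace K]
    {F : A → K → ℝ} (hF : Continuous (Function.uncurry F)) :
    Continuous (fun p : ProbabilityMeasure K × A => ∫ t, F p.2 t ∂(p.1 : Measure K)) := by
  -- Currying makes `a ↦ F a` continuous in the sup norm on compact `K`. Changing `a` then moves the
  -- integral by at most the sup distance, uniformly over all laws, which gives joint continuity.
  let Fc : C(A, C(K, ℝ)) := ContinuousMap.curry ⟨Function.uncurry F, hF⟩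
  have hFc : ∀ a t, Fc a t = F a t := fun _ _ => rfl
  rw [continuous_iff_continuousAt]
  rintro ⟨μ₀, a₀⟩
  rw [ContinuousAt, Metric.tendsto_nhds]
  intro δ hδ
  have h1 : ∀ᶠ a in 𝓝 a₀, dist (Fc a) (Fc a₀) < δ / 2 :=
    (Metric.tendsto_nhds.1 (Fc.continuous.tendsto a₀)) _ (half_pos hδ)
  have h2 : ∀ᶠ μ : ProbabilityMeasure K in 𝓝 μ₀, dist (∫ t, Fc a₀ t ∂(μ : Measure K)) (∫ t, Fc a₀ t ∂(μ₀ : Measure K))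
      < δ / 2 :=
    (Metric.tendsto_nhds.1
      ((ProbabilityMeasure.tendsto_iff_forall_integral_tendsto.1 (tendsto_id (x := 𝓝 μ₀)))
        (BoundedContinuousFunction.mkOfCompact (Fc a₀)))) _ (half_pos hδ)
  rw [nhds_prod_eq]
  filter_upwards [h2.prod_mk h1] with p hp
  obtain ⟨hp2, hp1⟩ := hp
  have hint : ∀ a, Integrable (fun t => Fc a t) (p.1 : Measure K) := fun a =>
    (BoundedContinuousFunction.mkOfCompact (Fc a)).integrable _
  have h3 : dist (∫ t, Fc p.2 t ∂(p.1 : Measure K)) (∫ t, Fc a₀ t ∂(p.1 : Measure K)) ≤ δ / 2 := by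
    rw [dist_eq_norm, ← integral_sub (hint _) (hint _)]
    refine (norm_integral_le_of_norm_le_const (C := δ / 2)
      (Eventually.of_forall fun t => ?_)).trans ?_
    · rw [← dist_eq_norm]
      exact (ContinuousMap.dist_apply_le_dist t).trans hp1.le
    · simp
  calc dist (∫ t, F p.2 t ∂(p.1 : Measure K)) (∫ t, F a₀ t ∂(μ₀ : Measure K))
      ≤ _ := dist_triangle _ (∫ t, Fc a₀ t ∂(p.1 : Measure K)) _
    _ < δ / 2 + δ / 2 := add_lt_add_of_le_of_lt h3 hp2
    _ = δ := by ring

/-- The law on `[-M, M]` obtained by projecting a law on the real line. -/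
noncomputable def clampLaw {M : ℝ} (hM : -M ≤ M) (π : ProbabilityMeasure ℝ) :
    ProbabilityMeasure (Set.Icc (-M) M) :=
  π.map (f := Set.projIcc (-M) M hM) continuous_projIcc.measurable.aemeasurable

/-- The law on the real line given by a law on `[-M, M]`. -/
noncomputable def extendLaw {M : ℝ} (μ : ProbabilityMeasure (Set.Icc (-M) M)) :
    ProbabilityMeasure ℝ :=
  μ.map (f := Subtype.val) measurable_subtype_coe.aemeasurable

theorem continuous_extendLaw {M : ℝ} : Continuous (extendLaw (M := M)) :=
  ProbabilityMeasure.continuous_map continuous_subtype_val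

theorem extendLaw_clampLaw {M : ℝ} (hM : -M ≤ M) {π : ProbabilityMeasure ℝ}
    (hπ : SupportedIn M π) : extendLaw (clampLaw hM π) = π := by
  apply Subtype.ext
  change Measure.map Subtype.val (Measure.map (Set.projIcc (-M) M hM) (π : Measure ℝ))
    = (π : Measure ℝ)
  rw [Measure.map_map measurable_subtype_coe continuous_projIcc.measurable]
  have h : ∀ᵐ x ∂(π : Measure ℝ), x ∈ Set.Icc (-M) M :=
    (prob_compl_eq_zero_iff measurableSet_Icc).2 hπ
  rw [Measure.map_congr (g := id), Measure.map_id]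
  filter_upwards [h] with x hx
  simp [Set.projIcc_of_mem hM hx]

theorem integral_extendLaw {M : ℝ} (μ : ProbabilityMeasure (Set.Icc (-M) M)) (f : ℝ → ℝ) :
    ∫ t, f t ∂(extendLaw μ : Measure ℝ) = ∫ t : Set.Icc (-M) M, f t ∂(μ : Measure _) := by
  change ∫ t, f t ∂(Measure.map Subtype.val (μ : Measure (Set.Icc (-M) M))) = _
  exact (MeasurableEmbedding.subtype_coe measurableSet_Icc).integral_map f

/-! ### Exponential tilting -/

theorem normalDensity_eq (x σ : ℝ) :
    normalDensity x σ = (√(2 * Real.pi * σ ^ 2))⁻¹ * Real.exp (-x ^ 2 / (2 * σ ^ 2)) := by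
  simp [normalDensity, gaussianPDFReal, Real.coe_toNNReal _ (sq_nonneg σ)]

/-- The ratio `φ(x - t; s) / φ(x; s)`. -/
noncomputable def tilt (x s t : ℝ) : ℝ := Real.exp ((x * t - t ^ 2 / 2) / s ^ 2)

/-- The term `x²` in the exponent does not involve `t`. It factors out of the mixture and cancels
from likelihood ratios and posterior means, leaving an exponent linear in `x`. -/
theorem normalDensity_sub (x s t : ℝ) :
    normalDensity (x - t) s = normalDensity x s * tilt x s t := by
  rw [normalDensity_eq, normalDensity_eq, tilt, mul_assoc _ (Real.exp _), ← Real.exp_add]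
  congr 2
  rw [mul_comm (2 : ℝ) (s ^ 2), ← div_div, ← div_div, ← sub_eq_zero]
  ring

theorem normalDensity_pos (x : ℝ) {s : ℝ} (hs : 0 < s) : 0 < normalDensity x s := by
  rw [normalDensity_eq]; positivity

theorem tilt_pos (x s t : ℝ) : 0 < tilt x s t := Real.exp_pos _

section Tilt

variable {M : ℝ}

/-- The ratio `f_{μ,s}(x) / φ(x; s)`. -/
noncomputable def tiltMass (μ : ProbabilityMeasure (Set.Icc (-M) M)) (x s : ℝ) : ℝ :=
  ∫ t : Set.Icc (-M) M, tilt x s t ∂(μ : Measure _)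

/-- The unnormalized tilted mean. -/
noncomputable def tiltMean (μ : ProbabilityMeasure (Set.Icc (-M) M)) (x s : ℝ) : ℝ :=
  ∫ t : Set.Icc (-M) M, t * tilt x s t ∂(μ : Measure _)

theorem mixDensity_extendLaw (μ : ProbabilityMeasure (Set.Icc (-M) M)) (s x : ℝ) :
    mixDensity (extendLaw μ) s x = normalDensity x s * tiltMass μ x s := by
  rw [mixDensity, integral_extendLaw, tiltMass, ← integral_const_mul]
  simp_rw [normalDensity_sub]

theorem postMean_extendLaw (μ : ProbabilityMeasure (Set.Icc (-M) M)) (x : ℝ) {s : ℝ}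
    (hs : 0 < s) : postMean (extendLaw μ) x s = tiltMean μ x s / tiltMass μ x s := by
  rw [postMean, integral_extendLaw, mixDensity_extendLaw, tiltMean]
  have : ∀ t : Set.Icc (-M) M, (t : ℝ) * normalDensity (x - t) s
      = normalDensity x s * (t * tilt x s t) := fun t => by rw [normalDensity_sub]; ring
  simp_rw [this]
  rw [integral_const_mul, mul_div_mul_left _ _ (normalDensity_pos x hs).ne']

theorem continuous_tilt_val (x s : ℝ) : Continuous fun t : Set.Icc (-M) M => tilt x s t := by
  unfold tilt; fun_prop

theorem integrable_tilt (μ : ProbabilityMeasure (Set.Icc (-M) M)) (x s : ℝ) :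
    Integrable (fun t : Set.Icc (-M) M => tilt x s t) (μ : Measure _) :=
  (BoundedContinuousFunction.mkOfCompact ⟨_, continuous_tilt_val x s⟩).integrable _

theorem abs_tilt_exponent_le {x s c t : ℝ} (hc : 0 < c) (hs : c ≤ s) (ht : t ∈ Set.Icc (-M) M) :
    |(x * t - t ^ 2 / 2) / s ^ 2| ≤ (M * |x| + M ^ 2) / c ^ 2 := by
  have htM : |t| ≤ M := abs_le.2 ht
  have hM : 0 ≤ M := (abs_nonneg t).trans htM
  rw [abs_div, abs_of_nonneg (sq_nonneg s)]
  have h1 : |x * t - t ^ 2 / 2| ≤ M * |x| + M ^ 2 := by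
    refine (abs_sub _ _).trans ?_
    rw [abs_mul, abs_of_nonneg (by positivity : 0 ≤ t ^ 2 / 2)]
    have : t ^ 2 ≤ M ^ 2 := sq_le_sq' ht.1 ht.2
    nlinarith [mul_le_mul_of_nonneg_left htM (abs_nonneg x), sq_nonneg M]
  gcongr

theorem tiltMass_bounds (μ : ProbabilityMeasure (Set.Icc (-M) M)) {x s c : ℝ} (hc : 0 < c)
    (hs : c ≤ s) :
    Real.exp (-((M * |x| + M ^ 2) / c ^ 2)) ≤ tiltMass μ x s ∧
      tiltMass μ x s ≤ Real.exp ((M * |x| + M ^ 2) / c ^ 2) := by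
  have h := fun t : Set.Icc (-M) M => abs_le.1 (abs_tilt_exponent_le (x := x) hc hs t.2)
  constructor
  · calc _ = ∫ _t : Set.Icc (-M) M, Real.exp (-((M * |x| + M ^ 2) / c ^ 2)) ∂(μ : Measure _) := by
          simp
      _ ≤ _ := integral_mono (integrable_const _) (integrable_tilt μ x s)
          fun t => Real.exp_le_exp.2 (h t).1
  · calc _ ≤ ∫ _t : Set.Icc (-M) M, Real.exp ((M * |x| + M ^ 2) / c ^ 2) ∂(μ : Measure _) :=
          integral_mono (integrable_tilt μ x s) (integrable_const _)
            fun t => Real.exp_le_exp.2 (h t).2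
      _ = _ := by simp

theorem tiltMass_pos (μ : ProbabilityMeasure (Set.Icc (-M) M)) (x : ℝ) {s : ℝ} (hs : 0 < s) :
    0 < tiltMass μ x s :=
  (Real.exp_pos _).trans_le (tiltMass_bounds μ hs le_rfl).1

/-- The growth is linear in `|x|` with constants free of `μ` and `s`, so a second moment bound on
the observations gives uniform integrability of log-likelihood ratios. -/
theorem abs_log_tiltMass_le (μ : ProbabilityMeasure (Set.Icc (-M) M)) {x s c : ℝ} (hc : 0 < c)
    (hs : c ≤ s) : |Real.log (tiltMass μ x s)| ≤ (M * |x| + M ^ 2) / c ^ 2 := by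
  have h := tiltMass_bounds μ (x := x) hc hs
  have hp := tiltMass_pos μ x (hc.trans_le hs)
  rw [abs_le]
  exact ⟨(Real.le_log_iff_exp_le hp).2 h.1, (Real.log_le_iff_le_exp hp).2 h.2⟩

theorem abs_tiltMean_le (μ : ProbabilityMeasure (Set.Icc (-M) M)) (x s : ℝ) :
    |tiltMean μ x s| ≤ M * tiltMass μ x s := by
  rw [tiltMean, tiltMass, ← integral_const_mul, ← Real.norm_eq_abs]
  refine norm_integral_le_of_norm_le ((integrable_tilt μ x s).const_mul M)
    (Eventually.of_forall fun t => ?_)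
  rw [Real.norm_eq_abs, abs_mul, abs_of_pos (tilt_pos x s t)]
  exact mul_le_mul_of_nonneg_right (abs_le.2 t.2) (tilt_pos x s t).le

theorem abs_postMean_extendLaw_le (μ : ProbabilityMeasure (Set.Icc (-M) M)) (x : ℝ) {s : ℝ}
    (hs : 0 < s) : |postMean (extendLaw μ) x s| ≤ M := by
  rw [postMean_extendLaw μ x hs, abs_div, abs_of_pos (tiltMass_pos μ x hs),
    div_le_iff₀ (tiltMass_pos μ x hs)]
  exact abs_tiltMean_le μ x s

variable {c C : ℝ}

theorem continuous_tilt (hc : 0 < c) : Continuous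
    (fun q : (ℝ × Set.Icc c C) × Set.Icc (-M) M => tilt q.1.1 q.1.2 q.2) := by
  unfold tilt
  refine Real.continuous_exp.comp (Continuous.div (by fun_prop) (by fun_prop) fun q => ?_)
  exact pow_ne_zero _ (hc.trans_le q.1.2.2.1).ne'

theorem continuous_tiltMass (hc : 0 < c) : Continuous
    (fun p : ProbabilityMeasure (Set.Icc (-M) M) × (ℝ × Set.Icc c C) =>
      tiltMass p.1 p.2.1 p.2.2) :=
  continuous_integral_param (F := fun (a : ℝ × Set.Icc c C) (t : Set.Icc (-M) M) =>
    tilt a.1 a.2 t) (continuous_tilt hc)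

theorem continuous_tiltMean (hc : 0 < c) : Continuous
    (fun p : ProbabilityMeasure (Set.Icc (-M) M) × (ℝ × Set.Icc c C) =>
      tiltMean p.1 p.2.1 p.2.2) :=
  continuous_integral_param (F := fun (a : ℝ × Set.Icc c C) (t : Set.Icc (-M) M) =>
    t * tilt a.1 a.2 t)
    ((continuous_subtype_val.comp continuous_snd).mul (continuous_tilt hc))

theorem continuous_log_tiltMass (hc : 0 < c) : Continuous
    (fun p : ProbabilityMeasure (Set.Icc (-M) M) × (ℝ × Set.Icc c C) =>
      Real.log (tiltMass p.1 p.2.1 p.2.2)) :=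
  (continuous_tiltMass hc).log fun p => (tiltMass_pos _ _ (hc.trans_le p.2.2.2.1)).ne'

theorem continuous_postMean_extendLaw (hc : 0 < c) : Continuous
    (fun p : ProbabilityMeasure (Set.Icc (-M) M) × (ℝ × Set.Icc c C) =>
      postMean (extendLaw p.1) p.2.1 p.2.2) := by
  have : (fun p : ProbabilityMeasure (Set.Icc (-M) M) × (ℝ × Set.Icc c C) =>
      postMean (extendLaw p.1) p.2.1 p.2.2) =
      fun p => tiltMean p.1 p.2.1 p.2.2 / tiltMass p.1 p.2.1 p.2.2 :=
    funext fun p => postMean_extendLaw _ _ (hc.trans_le p.2.2.2.1)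
  rw [this]
  exact (continuous_tiltMean hc).div (continuous_tiltMass hc)
    fun p => (tiltMass_pos _ _ (hc.trans_le p.2.2.2.1)).ne'

theorem continuous_normalDensity (hc : 0 < c) :
    Continuous (fun p : ℝ × Set.Icc c C => normalDensity p.1 p.2) := by
  simp_rw [normalDensity_eq]
  have h : ∀ p : ℝ × Set.Icc c C, (0 : ℝ) < p.2 := fun p => hc.trans_le p.2.2.1
  refine Continuous.mul (Continuous.inv₀ (by fun_prop) fun p => ?_)
    (Real.continuous_exp.comp (Continuous.div (by fun_prop) (by fun_prop) fun p => ?_))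
  · have := h p; positivity
  · have := h p; positivity

theorem continuous_mixDensity_extendLaw (hc : 0 < c) : Continuous
    (fun p : ProbabilityMeasure (Set.Icc (-M) M) × (ℝ × Set.Icc c C) =>
      mixDensity (extendLaw p.1) p.2.2 p.2.1) := by
  simp_rw [mixDensity_extendLaw]
  exact ((continuous_normalDensity hc).comp continuous_snd).mul (continuous_tiltMass hc)

end Tilt

/-! ### The normal experiment -/

theorem normalDensity_nonneg (x s : ℝ) : 0 ≤ normalDensity x s := gaussianPDFReal_nonneg _ _ _

theorem measurable_normalDensity_left (s : ℝ) : Measurable fun x => normalDensity x s :=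
  measurable_gaussianPDFReal _ _

theorem integrable_normalDensity_sub (π : ProbabilityMeasure ℝ) (s z : ℝ) :
    Integrable (fun t => normalDensity (z - t) s) (π : Measure ℝ) := by
  refine Integrable.of_bound (C := (√(2 * Real.pi * s ^ 2))⁻¹)
    ((measurable_normalDensity_left s).comp (by fun_prop)).aestronglyMeasurable
    (Eventually.of_forall fun t => ?_)
  rw [Real.norm_eq_abs, abs_of_nonneg (normalDensity_nonneg _ _), normalDensity_eq]
  refine mul_le_of_le_one_right (by positivity) (Real.exp_le_one_iff.2 ?_)
  exact div_nonpos_of_nonpos_of_nonneg (by nlinarith [sq_nonneg (z - t)]) (by positivity)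

instance isProbabilityMeasure_normalExperiment (π : ProbabilityMeasure ℝ) (s : ℝ) :
    IsProbabilityMeasure (normalExperiment π s) := by
  unfold normalExperiment; infer_instance

/-- For fixed `θ` the map translates the noise by `θ`, and Lebesgue measure is translation
invariant. -/
theorem map_normalExperiment (π : ProbabilityMeasure ℝ) {s : ℝ} (hs : 0 < s) :
    (normalExperiment π s).map (fun p => (p.1, p.1 + p.2)) =
      ((π : Measure ℝ).prod volume).withDensity
        (fun p => ENNReal.ofReal (normalDensity (p.2 - p.1) s)) := by
  have hv : (s ^ 2).toNNReal ≠ 0 := by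
    rw [Ne, Real.toNNReal_eq_zero, not_le]; positivity
  have hd : Measurable fun p : ℝ × ℝ => ENNReal.ofReal (normalDensity (p.2 - p.1) s) :=
    ((measurable_normalDensity_left s).comp (by fun_prop : Measurable fun p : ℝ × ℝ =>
      p.2 - p.1)).ennreal_ofReal
  refine Measure.ext_of_lintegral _ fun f hf => ?_
  rw [lintegral_map hf (by fun_prop), lintegral_withDensity_eq_lintegral_mul _ hd hf,
    normalExperiment, lintegral_prod _ (by fun_prop), lintegral_prod _ (hd.mul hf).aemeasurable]
  refine lintegral_congr fun t => ?_
  rw [gaussianReal_of_var_ne_zero _ hv, lintegral_withDensity_eq_lintegral_mul _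
    (measurable_gaussianPDF _ _) (by fun_prop)]
  rw [← lintegral_add_left_eq_self (fun z => ((fun p : ℝ × ℝ =>
    ENNReal.ofReal (normalDensity (p.2 - p.1) s)) * f) (t, z)) t]
  refine lintegral_congr fun e => ?_
  simp [gaussianPDF, normalDensity]

/-- The law of the observation in the normal experiment. -/
noncomputable def obsLaw (π : ProbabilityMeasure ℝ) (s : ℝ) : Measure ℝ :=
  (normalExperiment π s).map (fun p => p.1 + p.2)

instance isProbabilityMeasure_obsLaw (π : ProbabilityMeasure ℝ) (s : ℝ) :
    IsProbabilityMeasure (obsLaw π s) :=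
  Measure.isProbabilityMeasure_map (by fun_prop)

theorem measurable_mixDensity (π : ProbabilityMeasure ℝ) (s : ℝ) :
    Measurable (mixDensity π s) := by
  have : StronglyMeasurable fun p : ℝ × ℝ => normalDensity (p.1 - p.2) s :=
    ((measurable_normalDensity_left s).comp (by fun_prop)).stronglyMeasurable
  exact this.integral_prod_right.measurable

theorem mixDensity_nonneg (π : ProbabilityMeasure ℝ) (s x : ℝ) : 0 ≤ mixDensity π s x :=
  integral_nonneg fun _ => normalDensity_nonneg _ _

theorem obsLaw_eq_withDensity (π : ProbabilityMeasure ℝ) {s : ℝ} (hs : 0 < s) :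
    obsLaw π s = volume.withDensity (fun z => ENNReal.ofReal (mixDensity π s z)) := by
  have hd : Measurable fun p : ℝ × ℝ => ENNReal.ofReal (normalDensity (p.2 - p.1) s) :=
    ((measurable_normalDensity_left s).comp (by fun_prop : Measurable fun p : ℝ × ℝ =>
      p.2 - p.1)).ennreal_ofReal
  have h1 : obsLaw π s = ((normalExperiment π s).map (fun p => (p.1, p.1 + p.2))).map
      Prod.snd := by
    rw [Measure.map_map (by fun_prop) (by fun_prop)]; rfl
  refine Measure.ext_of_lintegral _ fun f hf => ?_
  rw [h1, map_normalExperiment π hs, lintegral_map hf (by fun_prop),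
    lintegral_withDensity_eq_lintegral_mul _ hd (by fun_prop),
    lintegral_prod_symm _ (hd.mul (by fun_prop)).aemeasurable,
    lintegral_withDensity_eq_lintegral_mul _ (measurable_mixDensity π s).ennreal_ofReal hf]
  refine lintegral_congr fun z => ?_
  simp only [Pi.mul_apply]
  have hz : Measurable fun t => ENNReal.ofReal (normalDensity (z - t) s) :=
    ((measurable_normalDensity_left s).comp
      (by fun_prop : Measurable fun t : ℝ => z - t)).ennreal_ofReal
  rw [lintegral_mul_const _ hz, mixDensity,
    ofReal_integral_eq_lintegral_ofReal (integrable_normalDensity_sub π s z)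
      (Eventually.of_forall fun _ => normalDensity_nonneg _ _)]

theorem integral_obsLaw (π : ProbabilityMeasure ℝ) {s : ℝ} (hs : 0 < s) (f : ℝ → ℝ) :
    ∫ z, f z ∂(obsLaw π s) = ∫ z, mixDensity π s z * f z := by
  rw [obsLaw_eq_withDensity π hs, integral_withDensity_eq_integral_toReal_smul
    (measurable_mixDensity π s).ennreal_ofReal (by simp)]
  simp [ENNReal.toReal_ofReal (mixDensity_nonneg π s _)]

theorem lintegral_mixDensity (π : ProbabilityMeasure ℝ) {s : ℝ} (hs : 0 < s) :
    ∫⁻ z, ENNReal.ofReal (mixDensity π s z) = 1 := by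
  have h : obsLaw π s Set.univ = 1 := measure_univ
  rwa [obsLaw_eq_withDensity π hs, withDensity_apply _ MeasurableSet.univ,
    Measure.restrict_univ] at h

theorem integrable_mixDensity (π : ProbabilityMeasure ℝ) {s : ℝ} (hs : 0 < s) :
    Integrable (mixDensity π s) := by
  refine ⟨(measurable_mixDensity π s).aestronglyMeasurable, ?_⟩
  rw [hasFiniteIntegral_iff_ofReal (Eventually.of_forall fun _ => mixDensity_nonneg π s _),
    lintegral_mixDensity π hs]
  exact ENNReal.one_lt_top

theorem integral_mixDensity (π : ProbabilityMeasure ℝ) {s : ℝ} (hs : 0 < s) :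
    ∫ z, mixDensity π s z = 1 := by
  rw [integral_eq_lintegral_of_nonneg_ae (Eventually.of_forall fun _ => mixDensity_nonneg π s _)
    (measurable_mixDensity π s).aestronglyMeasurable, lintegral_mixDensity π hs]
  simp

/-! ### Mixing laws on `[-M, M]`: moments, the oracle and log-likelihood ratios -/

section Compact

variable {M : ℝ}

theorem ae_extendLaw (μ : ProbabilityMeasure (Set.Icc (-M) M)) :
    ∀ᵐ t ∂(extendLaw μ : Measure ℝ), t ∈ Set.Icc (-M) M := by
  change ∀ᵐ t ∂(Measure.map Subtype.val (μ : Measure (Set.Icc (-M) M))), t ∈ Set.Icc (-M) M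
  exact (ae_map_iff (p := fun t => t ∈ Set.Icc (-M) M) measurable_subtype_coe.aemeasurable
    measurableSet_Icc).2 (Eventually.of_forall fun t => t.2)

theorem ae_normalExperiment_fst (μ : ProbabilityMeasure (Set.Icc (-M) M)) (s : ℝ) :
    ∀ᵐ p ∂(normalExperiment (extendLaw μ) s), p.1 ∈ Set.Icc (-M) M :=
  Measure.quasiMeasurePreserving_fst.ae (ae_extendLaw μ)

theorem memLp_two_fst (μ : ProbabilityMeasure (Set.Icc (-M) M)) (s : ℝ) :
    MemLp (fun p : ℝ × ℝ => p.1) 2 (normalExperiment (extendLaw μ) s) := by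
  refine MemLp.of_bound (by fun_prop) M ?_
  filter_upwards [ae_normalExperiment_fst μ s] with p hp
  exact abs_le.2 hp

theorem memLp_two_obs (μ : ProbabilityMeasure (Set.Icc (-M) M)) (s : ℝ) :
    MemLp (fun p : ℝ × ℝ => p.1 + p.2) 2 (normalExperiment (extendLaw μ) s) := by
  refine (memLp_two_fst μ s).add ?_
  have : MemLp id 2 (gaussianReal 0 (s ^ 2).toNNReal) := by
    simpa using memLp_id_gaussianReal (μ := 0) (v := (s ^ 2).toNNReal) 2
  exact this.comp_measurePreserving measurePreserving_snd

theorem integrable_abs_obsLaw (μ : ProbabilityMeasure (Set.Icc (-M) M)) (s : ℝ) :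
    Integrable (fun z => |z|) (obsLaw (extendLaw μ) s) := by
  rw [obsLaw, integrable_map_measure (by fun_prop) (by fun_prop)]
  exact ((memLp_two_obs μ s).integrable (by norm_num)).abs

theorem continuous_postMean_left (μ : ProbabilityMeasure (Set.Icc (-M) M)) {s : ℝ}
    (hs : 0 < s) : Continuous fun z => postMean (extendLaw μ) z s :=
  (continuous_postMean_extendLaw (M := M) (c := s) (C := s) hs).comp
    (continuous_const.prodMk (continuous_id.prodMk continuous_const) :
      Continuous fun z : ℝ => (μ, (z, (⟨s, le_rfl, le_rfl⟩ : Set.Icc s s))))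

theorem continuous_tiltMass_left (μ : ProbabilityMeasure (Set.Icc (-M) M)) {s : ℝ}
    (hs : 0 < s) : Continuous fun z => tiltMass μ z s :=
  (continuous_tiltMass (M := M) (c := s) (C := s) hs).comp
    (continuous_const.prodMk (continuous_id.prodMk continuous_const) :
      Continuous fun z : ℝ => (μ, (z, (⟨s, le_rfl, le_rfl⟩ : Set.Icc s s))))

/-- The posterior mean is the conditional expectation in the normal experiment. -/
theorem postMean_ae_eq_oraclePostMean (μ : ProbabilityMeasure (Set.Icc (-M) M)) {s : ℝ}
    (hs : 0 < s) :
    (fun p : ℝ × ℝ => postMean (extendLaw μ) (p.1 + p.2) s) =ᵐ[normalExperiment (extendLaw μ) s]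
      oraclePostMean (extendLaw μ) s := by
  set π := extendLaw μ
  have hcont := continuous_postMean_left μ hs
  have hadd : Measurable fun p : ℝ × ℝ => p.1 + p.2 := by fun_prop
  have hgint : Integrable (fun p : ℝ × ℝ => postMean π (p.1 + p.2) s) (normalExperiment π s) :=
    Integrable.of_bound (hcont.comp (by fun_prop)).aestronglyMeasurable M
      (Eventually.of_forall fun p => abs_postMean_extendLaw_le μ _ hs)
  have hfint : Integrable (fun p : ℝ × ℝ => p.1) (normalExperiment π s) :=
    (memLp_two_fst μ s).integrable (by norm_num)
  have hd : Measurable fun p : ℝ × ℝ => ENNReal.ofReal (normalDensity (p.2 - p.1) s) :=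
    ((measurable_normalDensity_left s).comp (by fun_prop : Measurable fun p : ℝ × ℝ =>
      p.2 - p.1)).ennreal_ofReal
  -- With the observation as the outer variable, testing against an event `{Z ∈ B}` reduces to the
  -- pointwise identity `f_π(z) h_π(z) = ∫ t φ(z - t) dπ(t)`.
  have key : ∀ H : ℝ × ℝ → ℝ, Measurable H →
      Integrable (fun p : ℝ × ℝ => H (p.1, p.1 + p.2)) (normalExperiment π s) →
      ∫ p, H (p.1, p.1 + p.2) ∂(normalExperiment π s) =
        ∫ z, ∫ t, normalDensity (z - t) s * H (t, z) ∂(π : Measure ℝ) := by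
    intro H hH hint
    have hpair : Measurable fun p : ℝ × ℝ => (p.1, p.1 + p.2) := by fun_prop
    have h1 := integrable_map_measure (μ := normalExperiment π s) (g := H)
      (f := fun p => (p.1, p.1 + p.2)) hH.aestronglyMeasurable hpair.aemeasurable
    have h2 : Integrable H ((normalExperiment π s).map fun p => (p.1, p.1 + p.2)) := h1.2 hint
    rw [map_normalExperiment π hs, integrable_withDensity_iff_integrable_smul' hd (by simp)] at h2
    rw [← integral_map (φ := fun p : ℝ × ℝ => (p.1, p.1 + p.2)) hpair.aemeasurable
      hH.aestronglyMeasurable,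
      map_normalExperiment π hs, integral_withDensity_eq_integral_toReal_smul hd (by simp),
      integral_prod_symm _ h2]
    simp [ENNReal.toReal_ofReal (normalDensity_nonneg _ _)]
  refine ae_eq_condExp_of_forall_setIntegral_eq hadd.comap_le hfint
    (fun _ _ _ => hgint.integrableOn) ?_ ?_
  · rintro _ ⟨B, hB, rfl⟩ -
    have hpre : MeasurableSet ((fun p : ℝ × ℝ => p.1 + p.2) ⁻¹' B) := hadd hB
    rw [← integral_indicator hpre, ← integral_indicator hpre]
    have e1 : ((fun p : ℝ × ℝ => p.1 + p.2) ⁻¹' B).indicator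
        (fun p : ℝ × ℝ => postMean π (p.1 + p.2) s) =
        fun p => (fun q : ℝ × ℝ => B.indicator (fun z => postMean π z s) q.2)
          (p.1, p.1 + p.2) := by
      ext p; rfl
    have e2 : ((fun p : ℝ × ℝ => p.1 + p.2) ⁻¹' B).indicator (fun p : ℝ × ℝ => p.1) =
        fun p => (fun q : ℝ × ℝ => B.indicator (fun _ => q.1) q.2) (p.1, p.1 + p.2) := by
      ext p; rfl
    have i1 := hgint.indicator hpre
    have i2 := hfint.indicator hpre
    rw [e1] at i1 ⊢
    rw [e2] at i2 ⊢
    have m1 : Measurable (fun q : ℝ × ℝ => B.indicator (fun z => postMean π z s) q.2) :=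
      (hcont.measurable.indicator hB).comp measurable_snd
    have m2 : Measurable (fun q : ℝ × ℝ => B.indicator (fun _ => q.1) q.2) := by
      have : (fun q : ℝ × ℝ => B.indicator (fun _ => q.1) q.2) =
          (Prod.snd ⁻¹' B).indicator Prod.fst := by
        ext q; rfl
      rw [this]
      exact measurable_fst.indicator (measurable_snd hB)
    rw [key _ m1 i1, key _ m2 i2]
    refine integral_congr_ae (Eventually.of_forall fun z => ?_)
    by_cases hz : z ∈ B
    · have hpos : mixDensity π s z ≠ 0 := by
        rw [mixDensity_extendLaw]
        exact (mul_pos (normalDensity_pos z hs) (tiltMass_pos μ z hs)).ne'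
      simp only [Set.indicator_of_mem hz]
      rw [integral_mul_const]
      change mixDensity π s z * postMean π z s = _
      rw [postMean, mul_div_cancel₀ _ hpos]
      simp_rw [mul_comm]
    · simp [Set.indicator_of_notMem hz]
  · exact (hcont.measurable.comp (comap_measurable _)).aestronglyMeasurable

theorem oracleRisk_extendLaw (μ : ProbabilityMeasure (Set.Icc (-M) M)) {s : ℝ} (hs : 0 < s) :
    oracleRisk (extendLaw μ) s =
      ∫ p, (p.1 - postMean (extendLaw μ) (p.1 + p.2) s) ^ 2 ∂(normalExperiment (extendLaw μ) s) :=
  integral_congr_ae <| by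
    filter_upwards [postMean_ae_eq_oraclePostMean μ hs] with p hp
    rw [hp]

/-! ### The Kullback–Leibler divergence identifies the mixing law -/

theorem extendLaw_injective : Function.Injective (extendLaw (M := M)) := by
  intro μ ν h
  apply Subtype.ext
  have h' : Measure.map Subtype.val (μ : Measure (Set.Icc (-M) M))
      = Measure.map Subtype.val (ν : Measure (Set.Icc (-M) M)) := congrArg Subtype.val h
  have := congrArg (Measure.comap (Subtype.val : Set.Icc (-M) M → ℝ)) h'
  rwa [(MeasurableEmbedding.subtype_coe measurableSet_Icc).comap_map,
    (MeasurableEmbedding.subtype_coe measurableSet_Icc).comap_map] at this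

theorem charFun_obsLaw (π : ProbabilityMeasure ℝ) (s t : ℝ) :
    charFun (obsLaw π s) t =
      charFun (π : Measure ℝ) t * Complex.exp (-((s ^ 2 * t ^ 2 / 2 : ℝ) : ℂ)) := by
  have h : obsLaw π s = (π : Measure ℝ).conv (gaussianReal 0 (s ^ 2).toNNReal) := rfl
  rw [h, charFun_conv, charFun_gaussianReal]
  congr 2
  simp [Real.coe_toNNReal _ (sq_nonneg s)]

/-- Identifiability: the Gaussian characteristic function never vanishes, so it can be divided out.
-/
theorem obsLaw_injective {π π' : ProbabilityMeasure ℝ} {s : ℝ} (h : obsLaw π s = obsLaw π' s) :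
    π = π' := by
  apply Subtype.ext
  change (π : Measure ℝ) = (π' : Measure ℝ)
  refine Measure.ext_of_charFun (funext fun t => ?_)
  have := congrArg (fun ρ => charFun ρ t) h
  simp only [charFun_obsLaw] at this
  exact mul_right_cancel₀ (Complex.exp_ne_zero _) this

/-- The log-likelihood ratio of two normal mixtures. -/
noncomputable def logRatio (μ ν : ProbabilityMeasure (Set.Icc (-M) M)) (x s : ℝ) : ℝ :=
  Real.log (tiltMass μ x s) - Real.log (tiltMass ν x s)

theorem abs_logRatio_le (μ ν : ProbabilityMeasure (Set.Icc (-M) M)) {x s c : ℝ} (hc : 0 < c)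
    (hs : c ≤ s) : |logRatio μ ν x s| ≤ 2 * ((M * |x| + M ^ 2) / c ^ 2) := by
  rw [two_mul]
  exact (abs_sub _ _).trans (add_le_add (abs_log_tiltMass_le μ hc hs)
    (abs_log_tiltMass_le ν hc hs))

theorem continuous_logRatio_left (μ ν : ProbabilityMeasure (Set.Icc (-M) M)) {s : ℝ}
    (hs : 0 < s) : Continuous fun x => logRatio μ ν x s :=
  ((continuous_tiltMass_left μ hs).log fun x => (tiltMass_pos μ x hs).ne').sub
    ((continuous_tiltMass_left ν hs).log fun x => (tiltMass_pos ν x hs).ne')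

theorem integrable_logRatio (μ ν : ProbabilityMeasure (Set.Icc (-M) M)) {s : ℝ} (hs : 0 < s) :
    Integrable (fun x => logRatio μ ν x s) (obsLaw (extendLaw ν) s) := by
  refine Integrable.mono' (g := fun x => 2 * ((M * |x| + M ^ 2) / s ^ 2)) ?_
    (continuous_logRatio_left μ ν hs).aestronglyMeasurable
    (Eventually.of_forall fun x => abs_logRatio_le μ ν hs le_rfl)
  exact ((((integrable_abs_obsLaw ν s).const_mul M).add (integrable_const _)).div_const _).const_mul
    _

theorem exp_logRatio (μ ν : ProbabilityMeasure (Set.Icc (-M) M)) (x : ℝ) {s : ℝ} (hs : 0 < s) :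
    Real.exp (logRatio μ ν x s) = tiltMass μ x s / tiltMass ν x s := by
  rw [logRatio, Real.exp_sub, Real.exp_log (tiltMass_pos μ x hs),
    Real.exp_log (tiltMass_pos ν x hs)]

theorem mixDensity_mul_exp_logRatio (μ ν : ProbabilityMeasure (Set.Icc (-M) M)) (x : ℝ) {s : ℝ}
    (hs : 0 < s) : mixDensity (extendLaw ν) s x * Real.exp (logRatio μ ν x s)
      = mixDensity (extendLaw μ) s x := by
  rw [exp_logRatio μ ν x hs, mixDensity_extendLaw, mixDensity_extendLaw, mul_assoc,
    mul_div_cancel₀ _ (tiltMass_pos ν x hs).ne']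

theorem integrable_exp_logRatio (μ ν : ProbabilityMeasure (Set.Icc (-M) M)) {s : ℝ}
    (hs : 0 < s) :
    Integrable (fun x => Real.exp (logRatio μ ν x s)) (obsLaw (extendLaw ν) s) := by
  rw [obsLaw_eq_withDensity _ hs, integrable_withDensity_iff_integrable_smul'
    (measurable_mixDensity _ s).ennreal_ofReal (by simp)]
  simp only [ENNReal.toReal_ofReal (mixDensity_nonneg _ s _), smul_eq_mul,
    mixDensity_mul_exp_logRatio μ ν _ hs]
  exact integrable_mixDensity _ hs

theorem integral_exp_logRatio (μ ν : ProbabilityMeasure (Set.Icc (-M) M)) {s : ℝ} (hs : 0 < s) :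
    ∫ x, Real.exp (logRatio μ ν x s) ∂(obsLaw (extendLaw ν) s) = 1 := by
  rw [integral_obsLaw _ hs]
  simp only [mixDensity_mul_exp_logRatio μ ν _ hs]
  exact integral_mixDensity _ hs

/-- Gibbs' inequality: integrate `e^y ≥ 1 + y` at the log ratio, whose exponential has mean one
under `ν`. Equality forces the log ratio to vanish almost everywhere, so the two observation laws
agree and identifiability gives `μ = ν`. -/
theorem integral_logRatio_neg {μ ν : ProbabilityMeasure (Set.Icc (-M) M)} (hne : μ ≠ ν) {s : ℝ}
    (hs : 0 < s) : ∫ x, logRatio μ ν x s ∂(obsLaw (extendLaw ν) s) < 0 := by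
  have h1 : Integrable (fun x => logRatio μ ν x s + 1) (obsLaw (extendLaw ν) s) :=
    (integrable_logRatio μ ν hs).add (integrable_const 1)
  have hint : Integrable (fun x => Real.exp (logRatio μ ν x s) - (logRatio μ ν x s + 1))
      (obsLaw (extendLaw ν) s) :=
    (integrable_exp_logRatio μ ν hs).sub h1
  have hnn : 0 ≤ᵐ[obsLaw (extendLaw ν) s]
      (fun x => Real.exp (logRatio μ ν x s) - (logRatio μ ν x s + 1)) :=
    Eventually.of_forall fun x => sub_nonneg.2 (Real.add_one_le_exp _)
  have hval : ∫ x, (Real.exp (logRatio μ ν x s) - (logRatio μ ν x s + 1)) ∂(obsLaw (extendLaw ν) s)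
      = - ∫ x, logRatio μ ν x s ∂(obsLaw (extendLaw ν) s) := by
    rw [integral_sub (integrable_exp_logRatio μ ν hs)
      h1, integral_exp_logRatio μ ν hs,
      integral_add (integrable_logRatio μ ν hs) (integrable_const 1)]
    simp
  have h0 := integral_nonneg_of_ae hnn
  rw [hval] at h0
  refine lt_of_le_of_ne (by linarith) fun hz => hne ?_
  rw [hz, neg_zero, integral_eq_zero_iff_of_nonneg_ae hnn hint] at hval
  apply extendLaw_injective
  apply obsLaw_injective (s := s)
  -- The mixture density is strictly positive, so a property that holds almost surely under the
  -- observation law holds Lebesgue-almost everywhere.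
  rw [obsLaw_eq_withDensity _ hs, ae_eq_comm, Filter.EventuallyEq,
    ae_withDensity_iff (measurable_mixDensity _ s).ennreal_ofReal] at hval
  rw [obsLaw_eq_withDensity _ hs, obsLaw_eq_withDensity _ hs]
  refine withDensity_congr_ae ?_
  filter_upwards [hval] with x hx
  have hpos : 0 < mixDensity (extendLaw ν) s x := by
    rw [mixDensity_extendLaw]
    exact mul_pos (normalDensity_pos x hs) (tiltMass_pos ν x hs)
  have hx' := hx (ENNReal.ofReal_pos.2 hpos).ne'
  have hl : logRatio μ ν x s = 0 := by
    by_contra hl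
    have := Real.add_one_lt_exp hl
    simp only [Pi.zero_apply] at hx'
    linarith
  rw [← mixDensity_mul_exp_logRatio μ ν x hs, hl, Real.exp_zero, mul_one]

end Compact

/-! ### Correlated normal observations -/

/-- Observations `Xᵢ = θᵢ + εᵢ` with i.i.d. `θᵢ ∼ π` and an independent noise vector
`ε ∼ N(0, Sig)` with marginal standard deviations `σᵢ`. -/
structure IsCorrelatedModel {n : ℕ} {Ω : Type*} [MeasurableSpace Ω] (P : Measure Ω)
    (π : ProbabilityMeasure ℝ) (Sig : Matrix (Fin n) (Fin n) ℝ) (σ : Fin n → ℝ)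
    (θ ε X : Fin n → Ω → ℝ) : Prop where
  posSemidef : Sig.PosSemidef
  pos : ∀ i, 0 < σ i
  diag : ∀ i, Sig i i = σ i ^ 2
  law_signal : ∀ i, HasLaw (θ i) (π : Measure ℝ) P
  indep_signal : iIndepFun θ P
  law_noise : HasLaw (fun ω => WithLp.toLp 2 (fun i => ε i ω)) (multivariateGaussian 0 Sig) P
  indep : IndepFun (fun ω i => ε i ω) (fun ω i => θ i ω) P
  obs : ∀ i ω, X i ω = θ i ω + ε i ω

/-! ### Entries of a positive semidefinite matrix -/

theorem quadForm_single_sub {n : ℕ} {S : Matrix (Fin n) (Fin n) ℝ} (hS : S.IsHermitian)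
    (i j : Fin n) :
    (Pi.single i 1 - Pi.single j 1 : Fin n → ℝ) ⬝ᵥ S.mulVec (Pi.single i 1 - Pi.single j 1) =
      S i i + S j j - 2 * S i j := by
  have h : S j i = S i j := by simpa using hS.apply i j
  simp [Matrix.mulVec_sub, sub_dotProduct, dotProduct_sub]
  rw [h]; ring

theorem PosSemidef.two_mul_apply_le {n : ℕ} {S : Matrix (Fin n) (Fin n) ℝ} (hS : S.PosSemidef)
    (i j : Fin n) : 2 * S i j ≤ S i i + S j j := by
  have h := hS.dotProduct_mulVec_nonneg (Pi.single i 1 - Pi.single j 1)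
  rw [star_trivial, quadForm_single_sub hS.isHermitian] at h
  linarith

open scoped MatrixOrder in
theorem exists_eq_star_mul_self {n : ℕ} {S : Matrix (Fin n) (Fin n) ℝ} (hS : S.PosSemidef) :
    ∃ A : Matrix (Fin n) (Fin n) ℝ, S = star A * A := by
  refine ⟨CFC.sqrt S, ?_⟩
  have hsa : IsSelfAdjoint (CFC.sqrt S) := (CFC.sqrt_nonneg S).isSelfAdjoint
  rw [hsa.star_eq, CFC.sqrt_mul_sqrt_self S hS.nonneg]

/-- The squared Hilbert–Schmidt norm of a positive semidefinite matrix is at most its operator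
norm times its trace. -/
theorem sum_sq_le_norm_mul_trace {n : ℕ} {S : Matrix (Fin n) (Fin n) ℝ} (hS : S.PosSemidef) :
    ∑ j, ∑ i, S i j ^ 2 ≤ ‖Matrix.toEuclideanCLM (n := Fin n) (𝕜 := ℝ) S‖ * ∑ j, S j j := by
  obtain ⟨A, hA⟩ := exists_eq_star_mul_self hS
  set T := Matrix.toEuclideanCLM (n := Fin n) (𝕜 := ℝ) S with hT
  set B := Matrix.toEuclideanCLM (n := Fin n) (𝕜 := ℝ) A
  have hTB : T = (ContinuousLinearMap.adjoint B).comp B := by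
    rw [hT, hA, map_mul, map_star]; rfl
  rw [Finset.mul_sum]
  -- Column by column: with `S = B* B`, `‖S eⱼ‖² ≤ ‖B‖² ‖B eⱼ‖² = ‖S‖ Sⱼⱼ`.
  refine Finset.sum_le_sum fun j _ => ?_
  set e : EuclideanSpace ℝ (Fin n) := EuclideanSpace.single j 1 with he
  have h1 : ∑ i, S i j ^ 2 = ‖T e‖ ^ 2 := by
    rw [EuclideanSpace.norm_sq_eq]
    refine Finset.sum_congr rfl fun i _ => ?_
    rw [hT, Matrix.ofLp_toEuclideanCLM, he, EuclideanSpace.single, Real.norm_eq_abs, sq_abs]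
    simp
  have h2 : S j j = ‖B e‖ ^ 2 := by
    have : inner ℝ e (T e) = S j j := by
      rw [hT, Matrix.inner_toEuclideanCLM, he, EuclideanSpace.single]
      simp
    rw [← this, hTB, ContinuousLinearMap.comp_apply,
      ContinuousLinearMap.adjoint_inner_right, real_inner_self_eq_norm_sq]
  have h3 : ‖T‖ = ‖B‖ * ‖B‖ := by rw [hTB, ContinuousLinearMap.norm_adjoint_comp_self]
  have h4 : ‖T e‖ ≤ ‖B‖ * ‖B e‖ := by
    rw [hTB, ContinuousLinearMap.comp_apply]
    exact ((ContinuousLinearMap.adjoint B).le_opNorm _).trans_eq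
      (by rw [LinearIsometryEquiv.norm_map])
  rw [h1, h2, h3, ← pow_two, ← mul_pow]
  exact pow_le_pow_left₀ (norm_nonneg _) h4 2

/-- Cauchy–Schwarz over the `n²` entries, followed by the Hilbert–Schmidt bound with trace at most
`n C²`. -/
theorem sum_abs_le_of_posSemidef {n : ℕ} {S : Matrix (Fin n) (Fin n) ℝ} (hS : S.PosSemidef)
    {C : ℝ} (hC : ∀ i, S i i ≤ C ^ 2) :
    ∑ j, ∑ i, |S i j| ≤
      n * √(‖Matrix.toEuclideanCLM (n := Fin n) (𝕜 := ℝ) S‖ * (n * C ^ 2)) := by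
  rw [← Fintype.sum_prod_type' (f := fun j i => |S i j|)]
  have h1 : ∑ p : Fin n × Fin n, S p.2 p.1 ^ 2 ≤
      ‖Matrix.toEuclideanCLM (n := Fin n) (𝕜 := ℝ) S‖ * (n * C ^ 2) := by
    rw [Fintype.sum_prod_type' (f := fun j i => S i j ^ 2)]
    refine (sum_sq_le_norm_mul_trace hS).trans ?_
    refine mul_le_mul_of_nonneg_left ?_ (norm_nonneg _)
    refine (Finset.sum_le_sum fun i _ => hC i).trans_eq ?_
    simp
  have h2 := sq_sum_le_card_mul_sum_sq (s := (Finset.univ : Finset (Fin n × Fin n)))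
    (f := fun p => |S p.2 p.1|)
  simp only [sq_abs, Finset.card_univ, Fintype.card_prod, Fintype.card_fin] at h2
  have h3 : (∑ p : Fin n × Fin n, |S p.2 p.1|) ^ 2 ≤
      n ^ 2 * (‖Matrix.toEuclideanCLM (n := Fin n) (𝕜 := ℝ) S‖ * (n * C ^ 2)) := by
    refine h2.trans ?_
    push_cast
    rw [← pow_two]
    exact mul_le_mul_of_nonneg_left h1 (by positivity)
  refine (Real.le_sqrt_of_sq_le h3).trans_eq ?_
  rw [Real.sqrt_mul (by positivity), Real.sqrt_sq (by positivity)]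

/-! ### Marginals of the model and covariances of complex exponentials -/

namespace IsCorrelatedModel

variable {n : ℕ} {Ω : Type*} [MeasurableSpace Ω] {P : Measure Ω}
  {π : ProbabilityMeasure ℝ} {Sig : Matrix (Fin n) (Fin n) ℝ} {σ : Fin n → ℝ}
  {θ ε X : Fin n → Ω → ℝ}

theorem hasLaw_noise (h : IsCorrelatedModel P π Sig σ θ ε X) (i : Fin n) :
    HasLaw (ε i) (gaussianReal 0 (σ i ^ 2).toNNReal) P := by
  have := (measurePreserving_eval_multivariateGaussian (μ := 0) h.posSemidef (i := i)).hasLaw.comp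
    h.law_noise
  rw [h.diag i] at this
  exact this

theorem hasLaw_pair [IsProbabilityMeasure P] (h : IsCorrelatedModel P π Sig σ θ ε X) (i : Fin n) :
    HasLaw (fun ω => (θ i ω, ε i ω)) (normalExperiment π (σ i)) P :=
  IndepFun.hasLaw_prod (h.law_signal i) (h.hasLaw_noise i)
    (h.indep.symm.comp (measurable_pi_apply i) (measurable_pi_apply i))

theorem aemeasurable_obs (h : IsCorrelatedModel P π Sig σ θ ε X) (i : Fin n) :
    AEMeasurable (X i) P := by
  have : X i = fun ω => θ i ω + ε i ω := funext (h.obs i)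
  rw [this]
  exact (h.law_signal i).aemeasurable.add (h.hasLaw_noise i).aemeasurable

theorem hasLaw_obs [IsProbabilityMeasure P] (h : IsCorrelatedModel P π Sig σ θ ε X) (i : Fin n) :
    HasLaw (X i) (obsLaw π (σ i)) P := by
  have h1 : HasLaw (fun p : ℝ × ℝ => p.1 + p.2) (obsLaw π (σ i)) (normalExperiment π (σ i)) :=
    ⟨by fun_prop, rfl⟩
  have h2 := h1.comp (h.hasLaw_pair i)
  have : X i = (fun p : ℝ × ℝ => p.1 + p.2) ∘ fun ω => (θ i ω, ε i ω) := funext (h.obs i)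
  rw [this]
  exact h2

theorem integral_cexp_obs [IsProbabilityMeasure P] (h : IsCorrelatedModel P π Sig σ θ ε X) (i : Fin n) (t : ℝ) :
    ∫ ω, Complex.exp (t * X i ω * Complex.I) ∂P = charFun (obsLaw π (σ i)) t := by
  rw [charFun_apply_real, ← (h.hasLaw_obs i).map_eq,
    integral_map (h.hasLaw_obs i).aemeasurable (by fun_prop)]

theorem integral_cexp_noise_sub (h : IsCorrelatedModel P π Sig σ θ ε X) (i j : Fin n) (t : ℝ) :
    ∫ ω, Complex.exp (t * (ε i ω - ε j ω) * Complex.I) ∂P =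
      Complex.exp ((-(t ^ 2 * (σ i ^ 2 + σ j ^ 2 - 2 * Sig i j) / 2) : ℝ)) := by
  -- The integral is the characteristic function of the whole noise vector at `t (eᵢ - eⱼ)`.
  set v : EuclideanSpace ℝ (Fin n) := t • WithLp.toLp 2 (Pi.single i 1 - Pi.single j 1) with hv
  have h1 := charFun_multivariateGaussian (μ := 0) h.posSemidef v
  have h2 : v.ofLp ⬝ᵥ Sig.mulVec v.ofLp = t ^ 2 * (σ i ^ 2 + σ j ^ 2 - 2 * Sig i j) := by
    rw [hv, WithLp.ofLp_smul, Matrix.mulVec_smul, smul_dotProduct, dotProduct_smul,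
      quadForm_single_sub h.posSemidef.isHermitian, h.diag, h.diag, smul_eq_mul, smul_eq_mul]
    ring
  rw [h2, inner_zero_right, charFun_apply, ← h.law_noise.map_eq,
    integral_map h.law_noise.aemeasurable (by fun_prop)] at h1
  convert h1 using 2
  · ext ω
    congr 2
    rw [hv, inner_smul_right, PiLp.inner_apply]
    simp [mul_sub, Finset.sum_sub_distrib, sub_mul, Pi.single_apply]
  · push_cast
    simp

theorem integral_cexp_obs_sub [IsProbabilityMeasure P] (h : IsCorrelatedModel P π Sig σ θ ε X) {i j : Fin n} (hij : i ≠ j)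
    (t : ℝ) :
    ∫ ω, Complex.exp (t * (X i ω - X j ω) * Complex.I) ∂P =
      charFun (π : Measure ℝ) t * charFun (π : Measure ℝ) (-t) *
      Complex.exp ((-(t ^ 2 * (σ i ^ 2 + σ j ^ 2 - 2 * Sig i j) / 2) : ℝ)) := by
  have mθ := fun i => (h.law_signal i).aemeasurable
  have mε := fun i => (h.hasLaw_noise i).aemeasurable
  have hchar : ∀ i (r : ℝ), ∫ ω, Complex.exp (r * θ i ω * Complex.I) ∂P =
      charFun (π : Measure ℝ) r := fun i r => by
    rw [charFun_apply_real, ← (h.law_signal i).map_eq, integral_map (mθ i) (by fun_prop)]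
  have hsplit : ∀ ω, Complex.exp (t * (X i ω - X j ω) * Complex.I) =
      (Complex.exp (t * θ i ω * Complex.I) * Complex.exp ((-t : ℝ) * θ j ω * Complex.I)) *
        Complex.exp (t * (ε i ω - ε j ω) * Complex.I) := fun ω => by
    rw [← Complex.exp_add, ← Complex.exp_add, h.obs, h.obs]
    congr 1
    push_cast
    ring
  simp_rw [hsplit]
  have hind1 : IndepFun
      (fun ω => Complex.exp (t * θ i ω * Complex.I) * Complex.exp ((-t : ℝ) * θ j ω * Complex.I))
      (fun ω => Complex.exp (t * (ε i ω - ε j ω) * Complex.I)) P :=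
    h.indep.symm.comp
      (φ := fun x : Fin n → ℝ => Complex.exp (t * x i * Complex.I) *
        Complex.exp ((-t : ℝ) * x j * Complex.I))
      (ψ := fun x : Fin n → ℝ => Complex.exp (t * (x i - x j) * Complex.I))
      (by fun_prop) (by fun_prop)
  have hind2 : IndepFun (fun ω => Complex.exp (t * θ i ω * Complex.I))
      (fun ω => Complex.exp ((-t : ℝ) * θ j ω * Complex.I)) P :=
    (h.indep_signal.indepFun hij).comp
      (φ := fun x : ℝ => Complex.exp (t * x * Complex.I))
      (ψ := fun x : ℝ => Complex.exp ((-t : ℝ) * x * Complex.I)) (by fun_prop) (by fun_prop)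
  have hm : ∀ i (r : ℝ), AEStronglyMeasurable (fun ω => Complex.exp (r * θ i ω * Complex.I)) P :=
    fun i r => by
      have := (mθ i); exact AEMeasurable.aestronglyMeasurable (by fun_prop)
  rw [hind1.integral_fun_mul_eq_mul_integral ((hm i t).mul (hm j (-t)))
      (AEMeasurable.aestronglyMeasurable (by fun_prop)),
    hind2.integral_fun_mul_eq_mul_integral (hm i t) (hm j (-t)), hchar, hchar,
    h.integral_cexp_noise_sub]

/-- For distinct indices the signals are independent, so the joint and the product expectation carry
the same signal factor, of modulus at most one. They differ only in Gaussian factors `e^a` and `e^b`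
with `a - b = t² Σᵢⱼ` and `a, b ≤ 0`, where the exponential is 1-Lipschitz. -/
theorem norm_cov_cexp_le [IsProbabilityMeasure P] (h : IsCorrelatedModel P π Sig σ θ ε X) {i j : Fin n} (hij : i ≠ j)
    (t : ℝ) :
    ‖∫ ω, Complex.exp (t * (X i ω - X j ω) * Complex.I) ∂P -
      charFun (obsLaw π (σ i)) t * charFun (obsLaw π (σ j)) (-t)‖ ≤ t ^ 2 * |Sig i j| := by
  rw [h.integral_cexp_obs_sub hij, charFun_obsLaw, charFun_obsLaw]
  set a : ℝ := -(t ^ 2 * (σ i ^ 2 + σ j ^ 2 - 2 * Sig i j) / 2) with ha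
  set b : ℝ := -(t ^ 2 * (σ i ^ 2 + σ j ^ 2) / 2) with hb
  have e : charFun (π : Measure ℝ) t * Complex.exp (-((σ i ^ 2 * t ^ 2 / 2 : ℝ) : ℂ)) *
      (charFun (π : Measure ℝ) (-t) * Complex.exp (-((σ j ^ 2 * (-t) ^ 2 / 2 : ℝ) : ℂ))) =
      charFun (π : Measure ℝ) t * charFun (π : Measure ℝ) (-t) * Complex.exp (b : ℝ) := by
    rw [mul_mul_mul_comm, ← Complex.exp_add]
    congr 2
    rw [hb]; push_cast; ring
  rw [e, ← mul_sub, norm_mul, norm_mul, ← Complex.ofReal_exp, ← Complex.ofReal_exp,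
    ← Complex.ofReal_sub, Complex.norm_real, Real.norm_eq_abs]
  have h1 : ‖charFun (π : Measure ℝ) t‖ * ‖charFun (π : Measure ℝ) (-t)‖ ≤ 1 :=
    mul_le_one₀ (norm_charFun_le_one _) (norm_nonneg _) (norm_charFun_le_one _)
  have ha0 : a ≤ 0 := by
    have := PosSemidef.two_mul_apply_le h.posSemidef i j
    rw [h.diag, h.diag] at this
    have : 0 ≤ t ^ 2 * (σ i ^ 2 + σ j ^ 2 - 2 * Sig i j) := mul_nonneg (sq_nonneg _) (by linarith)
    linarith
  have hb0 : b ≤ 0 := by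
    have : 0 ≤ t ^ 2 * (σ i ^ 2 + σ j ^ 2) := by positivity
    linarith
  have hab : a - b = t ^ 2 * Sig i j := by rw [ha, hb]; ring
  have hlip : ∀ x y : ℝ, x ≤ 0 → Real.exp x - Real.exp y ≤ |x - y| := fun x y hx => by
    have h1 := Real.add_one_le_exp (y - x)
    have h2 : Real.exp y = Real.exp x * Real.exp (y - x) := by rw [← Real.exp_add]; ring_nf
    have h3 : Real.exp x ≤ 1 := Real.exp_le_one_iff.2 hx
    have h4 := Real.exp_pos x
    have h5 : x - y ≤ |x - y| := le_abs_self _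
    have h6 := abs_nonneg (x - y)
    rw [h2]
    nlinarith
  have h2 : |Real.exp a - Real.exp b| ≤ t ^ 2 * |Sig i j| := by
    have : t ^ 2 * |Sig i j| = |a - b| := by rw [hab, abs_mul, abs_of_nonneg (sq_nonneg t)]
    rw [this, abs_le]
    have := hlip b a hb0
    rw [abs_sub_comm] at this
    exact ⟨by linarith, hlip a b ha0⟩
  calc _ ≤ 1 * |Real.exp a - Real.exp b| := mul_le_mul_of_nonneg_right h1 (abs_nonneg _)
    _ ≤ _ := by rwa [one_mul]

end IsCorrelatedModel

/-! ### Mean square of averages of centred characters -/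

namespace IsCorrelatedModel

/-- The centred character `w(e^{itXᵢ} - E e^{itXᵢ})`. -/
noncomputable def centredChar {n : ℕ} {Ω : Type*} (π : ProbabilityMeasure ℝ) (σ : Fin n → ℝ) (X : Fin n → Ω → ℝ)
    (t u : ℝ) (i : Fin n) (ω : Ω) : ℂ :=
  Complex.exp (u * σ i * Complex.I) *
    (Complex.exp (t * X i ω * Complex.I) - charFun (obsLaw π (σ i)) t)

theorem norm_exp_mul_I (a b : ℝ) : ‖Complex.exp (a * b * Complex.I)‖ = 1 := by
  rw [← Complex.ofReal_mul, Complex.norm_exp_ofReal_mul_I]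

theorem norm_centredChar_le {n : ℕ} {Ω : Type*} {π : ProbabilityMeasure ℝ} {σ : Fin n → ℝ}
    {X : Fin n → Ω → ℝ} (t u : ℝ) (i : Fin n) (ω : Ω) :
    ‖centredChar π σ X t u i ω‖ ≤ 2 := by
  rw [centredChar, norm_mul, norm_exp_mul_I, one_mul]
  refine (norm_sub_le _ _).trans ?_
  rw [norm_exp_mul_I]
  linarith [norm_charFun_le_one (μ := obsLaw π (σ i)) t]

variable {n : ℕ} {Ω : Type*} [MeasurableSpace Ω] {P : Measure Ω}
  {π : ProbabilityMeasure ℝ} {Sig : Matrix (Fin n) (Fin n) ℝ} {σ : Fin n → ℝ}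
  {θ ε X : Fin n → Ω → ℝ}

theorem aestronglyMeasurable_centredChar (h : IsCorrelatedModel P π Sig σ θ ε X) (t u : ℝ)
    (i : Fin n) : AEStronglyMeasurable (centredChar π σ X t u i) P := by
  have := h.aemeasurable_obs i
  unfold centredChar
  exact AEMeasurable.aestronglyMeasurable (by fun_prop)

theorem norm_integral_centredChar_mul_le [IsProbabilityMeasure P]
    (h : IsCorrelatedModel P π Sig σ θ ε X) (t u : ℝ) {i j : Fin n} (hij : i ≠ j) :
    ‖∫ ω, centredChar π σ X t u i ω * starRingEnd ℂ (centredChar π σ X t u j ω) ∂P‖ ≤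
      t ^ 2 * |Sig i j| := by
  set m := fun i => charFun (obsLaw π (σ i)) t with hm
  have hmj : charFun (obsLaw π (σ j)) (-t) = starRingEnd ℂ (m j) := charFun_neg t
  have hX := h.aemeasurable_obs
  have hconj : ∀ ω, starRingEnd ℂ (Complex.exp (t * X j ω * Complex.I)) =
      Complex.exp ((-t : ℝ) * X j ω * Complex.I) := fun ω => by
    rw [← Complex.exp_conj]
    simp
  have hint : ∀ (r : ℝ) k, Integrable (fun ω => Complex.exp (r * X k ω * Complex.I)) P :=
    fun r k => Integrable.of_bound (C := 1)
      (AEMeasurable.aestronglyMeasurable (by have := hX k; fun_prop))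
      (Eventually.of_forall fun ω => (norm_exp_mul_I _ _).le)
  have hint2 : Integrable (fun ω => Complex.exp (t * (X i ω - X j ω) * Complex.I)) P :=
    Integrable.of_bound (C := 1)
      (AEMeasurable.aestronglyMeasurable (by have := hX i; have := hX j; fun_prop))
      (Eventually.of_forall fun ω => by
        rw [← Complex.ofReal_sub]; exact (norm_exp_mul_I _ _).le)
  have hpt : ∀ ω, centredChar π σ X t u i ω * starRingEnd ℂ (centredChar π σ X t u j ω) =
      (Complex.exp (u * σ i * Complex.I) * starRingEnd ℂ (Complex.exp (u * σ j * Complex.I))) *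
      ((Complex.exp (t * (X i ω - X j ω) * Complex.I) -
        m i * Complex.exp ((-t : ℝ) * X j ω * Complex.I)) -
        (starRingEnd ℂ (m j) * Complex.exp (t * X i ω * Complex.I) -
          m i * starRingEnd ℂ (m j))) := fun ω => by
    have e : Complex.exp (t * (X i ω - X j ω) * Complex.I) =
        Complex.exp (t * X i ω * Complex.I) * Complex.exp ((-t : ℝ) * X j ω * Complex.I) := by
      rw [← Complex.exp_add]; congr 1; push_cast; ring
    rw [centredChar, centredChar, map_mul, map_sub, hconj, e]
    ring
  simp_rw [hpt]
  have e1 : Integrable (fun ω => Complex.exp (t * (X i ω - X j ω) * Complex.I) -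
      m i * Complex.exp ((-t : ℝ) * X j ω * Complex.I)) P := hint2.sub ((hint _ _).const_mul _)
  have e2 : Integrable (fun ω => starRingEnd ℂ (m j) * Complex.exp (t * X i ω * Complex.I) -
      m i * starRingEnd ℂ (m j)) P := ((hint _ _).const_mul _).sub (integrable_const _)
  rw [integral_const_mul, integral_sub e1 e2, integral_sub hint2 ((hint _ _).const_mul _),
    integral_sub ((hint _ _).const_mul _) (integrable_const _), integral_const_mul,
    integral_const_mul, h.integral_cexp_obs, h.integral_cexp_obs, hmj, norm_mul, norm_mul,
    RCLike.norm_conj, norm_exp_mul_I, norm_exp_mul_I, one_mul, one_mul]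
  have := h.norm_cov_cexp_le hij t
  rw [hmj] at this
  rw [mul_comm (starRingEnd ℂ (m j))]
  simpa [hm] using this

theorem integral_norm_sq_sum_le [IsProbabilityMeasure P]
    (h : IsCorrelatedModel P π Sig σ θ ε X) (t u : ℝ) :
    ∫ ω, ‖∑ i, centredChar π σ X t u i ω‖ ^ 2 ∂P ≤
      4 * n + t ^ 2 * ∑ j, ∑ i, |Sig i j| := by
  have hint : ∀ i j, Integrable (fun ω => centredChar π σ X t u i ω *
      starRingEnd ℂ (centredChar π σ X t u j ω)) P := fun i j => by
    refine Integrable.of_bound (C := 2 * 2)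
      ((h.aestronglyMeasurable_centredChar t u i).mul
        (Complex.continuous_conj.comp_aestronglyMeasurable
          (h.aestronglyMeasurable_centredChar t u j)))
      (Eventually.of_forall fun ω => ?_)
    rw [norm_mul, RCLike.norm_conj]
    exact mul_le_mul (norm_centredChar_le ..) (norm_centredChar_le ..) (norm_nonneg _)
      (by norm_num)
  have h1 : ((∫ ω, ‖∑ i, centredChar π σ X t u i ω‖ ^ 2 ∂P : ℝ) : ℂ) =
      ∑ j, ∑ i, ∫ ω, centredChar π σ X t u i ω *
        starRingEnd ℂ (centredChar π σ X t u j ω) ∂P := by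
    rw [← integral_complex_ofReal]
    have : ∀ ω, ((‖∑ i, centredChar π σ X t u i ω‖ ^ 2 : ℝ) : ℂ) =
        ∑ j, ∑ i, centredChar π σ X t u i ω *
          starRingEnd ℂ (centredChar π σ X t u j ω) := fun ω => by
      push_cast
      rw [← Complex.mul_conj', map_sum, Finset.sum_mul_sum, Finset.sum_comm]
    simp_rw [this]
    rw [integral_finsetSum _ fun j _ => integrable_finsetSum _ fun i _ => hint i j]
    exact Finset.sum_congr rfl fun j _ => integral_finsetSum _ fun i _ => hint i j
  have h2 : ∀ i j, ‖∫ ω, centredChar π σ X t u i ω *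
      starRingEnd ℂ (centredChar π σ X t u j ω) ∂P‖ ≤
        (if i = j then 4 else 0) + t ^ 2 * |Sig i j| := by
    intro i j
    by_cases hij : i = j
    · rw [if_pos hij]
      have : ‖∫ ω, centredChar π σ X t u i ω *
          starRingEnd ℂ (centredChar π σ X t u j ω) ∂P‖ ≤ 4 := by
        refine (norm_integral_le_of_norm_le_const (C := 4)
          (Eventually.of_forall fun ω => ?_)).trans (by simp)
        rw [norm_mul, RCLike.norm_conj, show (4 : ℝ) = 2 * 2 by norm_num]
        exact mul_le_mul (norm_centredChar_le ..) (norm_centredChar_le ..) (norm_nonneg _)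
          (by norm_num)
      have : 0 ≤ t ^ 2 * |Sig i j| := by positivity
      linarith
    · rw [if_neg hij, zero_add]
      exact h.norm_integral_centredChar_mul_le t u hij
  have h3 : ∫ ω, ‖∑ i, centredChar π σ X t u i ω‖ ^ 2 ∂P =
      ‖((∫ ω, ‖∑ i, centredChar π σ X t u i ω‖ ^ 2 ∂P : ℝ) : ℂ)‖ := by
    rw [Complex.norm_real, Real.norm_eq_abs, abs_of_nonneg (integral_nonneg fun _ => by positivity)]
  rw [h3, h1]
  refine (norm_sum_le _ _).trans ((Finset.sum_le_sum fun j _ =>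
    (norm_sum_le _ _).trans (Finset.sum_le_sum fun i _ => h2 i j)).trans_eq ?_)
  simp_rw [Finset.sum_add_distrib, ← Finset.mul_sum]
  simp [mul_comm]

/-- The `n` diagonal terms are at most `4` each and give `4 / n`; the off-diagonal covariances give
the second term, which vanishes when the operator norm is `o(n)`. -/
theorem integral_norm_sq_average_le [IsProbabilityMeasure P]
    (h : IsCorrelatedModel P π Sig σ θ ε X) (hn : 0 < n) {C : ℝ} (hC : 0 ≤ C)
    (hσC : ∀ i, σ i ≤ C) (t u : ℝ) :
    ∫ ω, ‖(n : ℂ)⁻¹ * ∑ i, centredChar π σ X t u i ω‖ ^ 2 ∂P ≤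
      4 * (n : ℝ)⁻¹ + t ^ 2 * (C *
        √(‖Matrix.toEuclideanCLM (n := Fin n) (𝕜 := ℝ) Sig‖ / n)) := by
  have hn' : (0 : ℝ) < n := Nat.cast_pos.2 hn
  have h1 := h.integral_norm_sq_sum_le t u
  have h2 := sum_abs_le_of_posSemidef h.posSemidef (C := C) fun i => by
    rw [h.diag]; exact pow_le_pow_left₀ (h.pos i).le (hσC i) 2
  set N := ‖Matrix.toEuclideanCLM (n := Fin n) (𝕜 := ℝ) Sig‖
  have h3 : √(N * (n * C ^ 2)) = n * (C * √(N / n)) := by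
    rw [show N * (n * C ^ 2) = (n * C) ^ 2 * (N / n) by field_simp,
      Real.sqrt_mul (sq_nonneg _), Real.sqrt_sq (by positivity)]
    ring
  rw [h3] at h2
  simp_rw [norm_mul, mul_pow]
  rw [integral_const_mul, norm_inv, Complex.norm_natCast]
  calc _ ≤ ((n : ℝ)⁻¹) ^ 2 * (4 * n + t ^ 2 * (n * (n * (C * √(N / n))))) := by
        gcongr
        refine h1.trans ?_
        gcongr
    _ = _ := by field_simp

end IsCorrelatedModel

/-! ### Convergence in probability as convergence along a filter -/

section ProbFilter

variable {Ω : ℕ → Type*} [∀ n, MeasurableSpace (Ω n)]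

/-- The filter of the sets of outcomes whose probability tends to one. -/
def probFilter (P : ∀ n, Measure (Ω n)) : Filter (Σ n, Ω n) where
  sets := {A | Tendsto (fun n => P n {ω | (⟨n, ω⟩ : Σ n, Ω n) ∉ A}) atTop (𝓝 0)}
  univ_sets := by simp
  sets_of_superset := fun {A B} hA hAB =>
    tendsto_of_tendsto_of_tendsto_of_le_of_le tendsto_const_nhds hA (fun _ => zero_le)
      fun _ => measure_mono fun _ hω h => hω (hAB h)
  inter_sets := fun {A B} hA hB => by
    have h := hA.add hB
    rw [add_zero] at h
    refine tendsto_of_tendsto_of_tendsto_of_le_of_le tendsto_const_nhds h (fun _ => zero_le)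
      fun n => (measure_mono fun ω hω => ?_).trans (measure_union_le _ _)
    by_contra hc
    simp only [Set.mem_union, Set.mem_ofPred_eq, not_or, not_not] at hc
    exact hω hc

variable {P : ∀ n, Measure (Ω n)}

theorem mem_probFilter {A : Set (Σ n, Ω n)} : A ∈ probFilter P ↔
    Tendsto (fun n => P n {ω | (⟨n, ω⟩ : Σ n, Ω n) ∉ A}) atTop (𝓝 0) := Iff.rfl

/-- This turns convergence in probability into ordinary convergence, to which continuity, squeezing
and ultrafilters apply even though the probability spaces vary with `n`. -/
theorem tendstoInProb_iff {E : Type*} [TopologicalSpace E] {Y : ∀ n, Ω n → E} {a : E} :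
    TendstoInProb P Y a ↔ Tendsto (fun z : Σ n, Ω n => Y z.1 z.2) (probFilter P) (𝓝 a) :=
  Iff.rfl

theorem tendsto_fst_probFilter : Tendsto Sigma.fst (probFilter P) atTop := by
  refine tendsto_atTop.2 fun m => ?_
  refine tendsto_const_nhds.congr' ?_
  filter_upwards [eventually_ge_atTop m] with n hn
  simp [hn]

theorem eventually_probFilter_of_ae {p : ∀ n, Ω n → Prop} (h : ∀ n, ∀ᵐ ω ∂(P n), p n ω) :
    ∀ᶠ z : Σ n, Ω n in probFilter P, p z.1 z.2 := by
  refine tendsto_const_nhds.congr fun n => ?_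
  exact (ae_iff.1 (h n)).symm

theorem tendsto_probFilter_of_integral [∀ n, IsProbabilityMeasure (P n)] {f : ∀ n, Ω n → ℝ}
    (hf : ∀ n ω, 0 ≤ f n ω) (hint : ∀ n, Integrable (f n) (P n))
    (h : Tendsto (fun n => ∫ ω, f n ω ∂(P n)) atTop (𝓝 0)) :
    Tendsto (fun z : Σ n, Ω n => f z.1 z.2) (probFilter P) (𝓝 0) := by
  rw [Metric.tendsto_nhds]
  intro δ hδ
  have h1 : Tendsto (fun n => ENNReal.ofReal ((∫ ω, f n ω ∂(P n)) / δ)) atTop (𝓝 0) := by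
    have := ENNReal.tendsto_ofReal (h.div_const δ)
    simpa using this
  refine tendsto_of_tendsto_of_tendsto_of_le_of_le tendsto_const_nhds h1 (fun _ => zero_le)
    fun n => ?_
  have h2 := mul_meas_ge_le_integral_of_nonneg (Eventually.of_forall (hf n)) (hint n) δ
  rw [mul_comm, ← le_div_iff₀ hδ] at h2
  have h3 : {ω | (⟨n, ω⟩ : Σ n, Ω n) ∉ {z : Σ n, Ω n | dist (f z.1 z.2) 0 < δ}} =
      {ω | δ ≤ f n ω} := by
    ext ω
    simp [abs_of_nonneg (hf n ω)]
  rw [h3]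
  refine (ENNReal.le_ofReal_iff_toReal_le (measure_ne_top _ _) ?_).2 h2
  exact div_nonneg (integral_nonneg (hf n)) hδ.le

end ProbFilter

/-! ### Empirical measures and their limits -/

/-- The empirical measure of a finite sample. -/
noncomputable def empirical {E : Type*} [MeasurableSpace E] {n : ℕ} (hn : 0 < n)
    (x : Fin n → E) : ProbabilityMeasure E :=
  ⟨(n : ENNReal)⁻¹ • ∑ i, Measure.dirac (x i), ⟨by
    simp [ENNReal.inv_mul_cancel (Nat.cast_ne_zero.2 hn.ne') (ENNReal.natCast_ne_top n)]⟩⟩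

section Empirical

variable {E : Type*} [MeasurableSpace E] [MeasurableSingletonClass E] {n : ℕ}

theorem integral_empirical {G : Type*} [NormedAddCommGroup G] [NormedSpace ℝ G]
    [CompleteSpace G] (hn : 0 < n) (x : Fin n → E) (f : E → G) :
    ∫ p, f p ∂(empirical hn x : Measure E) = (n : ℝ)⁻¹ • ∑ i, f (x i) := by
  change ∫ p, f p ∂((n : ENNReal)⁻¹ • ∑ i, Measure.dirac (x i)) = _
  rw [integral_smul_measure, integral_finsetSum_measure fun i _ =>
    integrable_dirac (by simp)]
  simp

theorem integrable_empirical {G : Type*} [NormedAddCommGroup G] (hn : 0 < n) (x : Fin n → E)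
    (f : E → G) : Integrable f (empirical hn x : Measure E) := by
  change Integrable f ((n : ENNReal)⁻¹ • ∑ i, Measure.dirac (x i))
  refine Integrable.smul_measure ?_ (by simp [hn.ne'])
  rw [integrable_finsetSum_measure]
  exact fun i _ => integrable_dirac (by simp)

theorem integral_empirical_eq_avg (hn : 0 < n) (x : Fin n → E) (f : E → ℝ) :
    ∫ p, f p ∂(empirical hn x : Measure E) = avg fun i => f (x i) := by
  rw [integral_empirical, avg, one_div, smul_eq_mul]

end Empirical

section Limits

variable {S : Type*} [TopologicalSpace S] [CompactSpace S] [T2Space S]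
  [SecondCountableTopology S] [MeasurableSpace S] [BorelSpace S]

/-- Laws on `ℝ × S` with a uniform second moment bound. -/
def secondMomentLe (S : Type*) [MeasurableSpace S] (B : ℝ) : Set (ProbabilityMeasure (ℝ × S)) :=
  {ν | Integrable (fun p : ℝ × S => p.1 ^ 2) (ν : Measure (ℝ × S)) ∧
    ∫ p, p.1 ^ 2 ∂(ν : Measure (ℝ × S)) ≤ B}

/-- Since `S` is compact, mass can escape only along the real coordinate, and Chebyshev's inequality
prevents that; Prokhorov's theorem concludes. -/
theorem isCompact_closure_secondMomentLe (B : ℝ) : IsCompact (closure (secondMomentLe S B)) := by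
  refine isCompact_closure_of_isTightMeasureSet ?_
  rw [isTightMeasureSet_iff_exists_isCompact_measure_compl_le]
  intro δ hδ
  have h0 : Tendsto (fun R : ℝ => ENNReal.ofReal (B / R ^ 2)) atTop (𝓝 0) := by
    have h : Tendsto (fun R : ℝ => B / R ^ 2) atTop (𝓝 0) :=
      tendsto_const_nhds.div_atTop (tendsto_pow_atTop two_ne_zero)
    simpa using ENNReal.tendsto_ofReal h
  obtain ⟨R, hR, hR0⟩ := ((h0.eventually_le_const hδ).and (eventually_gt_atTop 0)).exists
  refine ⟨Set.Icc (-R) R ×ˢ Set.univ, isCompact_Icc.prod isCompact_univ, ?_⟩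
  rintro _ ⟨ν, ⟨hint, hB⟩, rfl⟩
  have h1 := mul_meas_ge_le_integral_of_nonneg
    (Eventually.of_forall fun p : ℝ × S => sq_nonneg p.1) hint (R ^ 2)
  have h2 : (ν : Measure (ℝ × S)).real {p | R ^ 2 ≤ p.1 ^ 2} ≤ B / R ^ 2 := by
    rw [le_div_iff₀ (by positivity), mul_comm]
    exact h1.trans hB
  refine (measure_mono fun p hp => ?_).trans
    (((ENNReal.le_ofReal_iff_toReal_le (measure_ne_top _ _) ?_).2 h2).trans hR)
  · simp only [Set.mem_compl_iff, Set.mem_prod, Set.mem_univ, and_true] at hp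
    change R ^ 2 ≤ p.1 ^ 2
    rw [← sq_abs p.1]
    exact pow_le_pow_left₀ hR0.le (not_le.1 fun h => hp (abs_le.1 h)).le 2
  · exact measureReal_nonneg.trans h2

/-- Continuous functions of linear growth integrate continuously along weakly convergent laws with
bounded second moments, jointly with a parameter. -/
theorem tendsto_integral_of_linear_growth {A ι : Type*} [TopologicalSpace A] {l : Filter ι}
    {F : A → ℝ × S → ℝ} (hF : Continuous (Function.uncurry F)) {α β : ℝ} (hα : 0 ≤ α)
    (hβ : 0 ≤ β) (hFb : ∀ a p, |F a p| ≤ α * |p.1| + β) {a : ι → A} {a₀ : A}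
    (ha : Tendsto a l (𝓝 a₀)) {ν : ι → ProbabilityMeasure (ℝ × S)}
    {ν₀ : ProbabilityMeasure (ℝ × S)} (hν : Tendsto ν l (𝓝 ν₀)) {B : ℝ}
    (hB : ∀ᶠ i in l, ν i ∈ secondMomentLe S B)
    (hν₀ : Integrable (fun p : ℝ × S => |p.1|) (ν₀ : Measure (ℝ × S))) :
    Tendsto (fun i => ∫ p, F (a i) p ∂(ν i : Measure (ℝ × S))) l
      (𝓝 (∫ p, F a₀ p ∂(ν₀ : Measure (ℝ × S)))) := by
  have hcont : ∀ b, Continuous (F b) := fun b =>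
    hF.comp (continuous_const.prodMk continuous_id)
  have hR : ∀ k : ℕ, -((k : ℝ) + 1) ≤ (k : ℝ) + 1 := fun k => by
    have : (0 : ℝ) ≤ k := Nat.cast_nonneg k
    linarith
  -- Clipping the real coordinate moves the integral to a compact space, where
  -- `continuous_integral_param` applies. The level `k + 1` is at least one for every `k`.
  let clip : ∀ k : ℕ, ℝ × S → Set.Icc (-((k : ℝ) + 1)) (k + 1) × S := fun k p =>
    (Set.projIcc _ _ (hR k) p.1, p.2)
  have hclip : ∀ k, Continuous (clip k) := fun k => by
    exact (continuous_projIcc.comp continuous_fst).prodMk continuous_snd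
  let FR : ∀ k : ℕ, A → ℝ × S → ℝ := fun k b p => F b ((clip k p).1, p.2)
  have hFRcont : ∀ k b, Continuous (FR k b) := fun k b =>
    (hcont b).comp ((continuous_subtype_val.comp (continuous_fst.comp (hclip k))).prodMk
      continuous_snd)
  have habs : ∀ k (p : ℝ × S), |((clip k p).1 : ℝ)| ≤ |p.1| := fun k p => by
    have hk : (0 : ℝ) ≤ k := Nat.cast_nonneg k
    simp only [clip, Set.coe_projIcc]
    rcases le_total 0 p.1 with h | h
    · rw [abs_of_nonneg h, abs_le]
      exact ⟨by have : 0 ≤ max (-((k : ℝ) + 1)) (min (k + 1) p.1) :=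
                  le_max_of_le_right (le_min (by linarith) h)
                linarith,
        max_le (by linarith) (min_le_right _ _)⟩
    · rw [abs_of_nonpos h, abs_le]
      exact ⟨by rw [neg_neg]; exact le_max_of_le_right (le_min (by linarith) le_rfl),
        max_le (by linarith) (by linarith [min_le_right ((k : ℝ) + 1) p.1])⟩
  have hclip_eq : ∀ (k : ℕ) (p : ℝ × S), |p.1| ≤ k + 1 → ∀ b, FR k b p = F b p := fun k p hp b => by
    simp only [FR, clip, Set.projIcc_of_mem (hR k) (abs_le.1 hp)]
  have hFRb : ∀ k b p, |FR k b p| ≤ α * |p.1| + β := fun k b p =>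
    (hFb b _).trans (add_le_add_left (mul_le_mul_of_nonneg_left (habs k p) hα) β)
  -- Clipping changes something only where `|p.1| > k + 1 ≥ 1`. There both `|p.1|` and `1` are at
  -- most `p.1² / (k + 1)`, so the second moment controls the error uniformly in the law.
  have hdiff : ∀ k b p, |F b p - FR k b p| ≤ 2 * (α + β) / (k + 1) * p.1 ^ 2 := fun k b p => by
    have hk : (0 : ℝ) ≤ k := Nat.cast_nonneg k
    by_cases hp : |p.1| ≤ k + 1
    · rw [hclip_eq k p hp, sub_self, abs_zero]
      positivity
    · rw [not_le] at hp
      refine (abs_sub _ _).trans ((add_le_add (hFb b p) (hFRb k b p)).trans ?_)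
      rw [← sq_abs p.1, div_mul_eq_mul_div, le_div_iff₀ (by positivity)]
      have h1 : 1 * (k + 1) ≤ |p.1| * |p.1| :=
        mul_le_mul (by linarith) hp.le (by positivity) (abs_nonneg _)
      have h2 : |p.1| * (k + 1) ≤ |p.1| * |p.1| := mul_le_mul_of_nonneg_left hp.le (abs_nonneg _)
      nlinarith
  have hmid : ∀ k, Tendsto (fun i => ∫ p, FR k (a i) p ∂(ν i : Measure (ℝ × S))) l
      (𝓝 (∫ p, FR k a₀ p ∂(ν₀ : Measure (ℝ × S)))) := fun k => by
    have hmap : ∀ (ρ : ProbabilityMeasure (ℝ × S)) b,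
        ∫ q : Set.Icc (-((k : ℝ) + 1)) (k + 1) × S, F b (q.1, q.2)
          ∂(ρ.map (hclip k).measurable.aemeasurable : Measure _) =
        ∫ p, FR k b p ∂(ρ : Measure (ℝ × S)) := fun ρ b => by
      change ∫ q, _ ∂(Measure.map (clip k) (ρ : Measure (ℝ × S))) = _
      rw [integral_map (hclip k).measurable.aemeasurable]
      exact Continuous.aestronglyMeasurable ((hcont b).comp (by fun_prop))
    have h := continuous_integral_param (K := Set.Icc (-((k : ℝ) + 1)) (k + 1) × S)
      (F := fun b q => F b (q.1, q.2)) (hF.comp (by fun_prop :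
        Continuous fun r : A × (Set.Icc (-((k : ℝ) + 1)) (k + 1) × S) =>
          (r.1, ((r.2.1 : ℝ), r.2.2))))
    have h' := (h.tendsto (ν₀.map (hclip k).measurable.aemeasurable, a₀)).comp
      ((((ProbabilityMeasure.continuous_map (hclip k)).tendsto ν₀).comp hν).prodMk_nhds ha)
    simp only [Function.comp_def, hmap] at h'
    exact h'
  have hlim : Tendsto (fun k => ∫ p, FR k a₀ p ∂(ν₀ : Measure (ℝ × S))) atTop
      (𝓝 (∫ p, F a₀ p ∂(ν₀ : Measure (ℝ × S)))) := by
    refine tendsto_integral_of_dominated_convergence (fun p => α * |p.1| + β)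
      (fun k => (hFRcont k a₀).aestronglyMeasurable)
      ((hν₀.const_mul α).add (integrable_const β))
      (fun k => Eventually.of_forall fun p => hFRb k a₀ p) (Eventually.of_forall fun p => ?_)
    refine tendsto_const_nhds.congr' ?_
    obtain ⟨m, hm⟩ := exists_nat_ge |p.1|
    filter_upwards [eventually_ge_atTop m] with k hk
    refine (hclip_eq k p (hm.trans ?_) a₀).symm
    have : (m : ℝ) ≤ k := Nat.cast_le.2 hk
    linarith
  rw [Metric.tendsto_nhds]
  intro δ hδ
  have hsmall : Tendsto (fun k : ℕ => 2 * (α + β) * |B| / ((k : ℝ) + 1)) atTop (𝓝 0) :=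
    tendsto_const_nhds.div_atTop
      (tendsto_atTop_add_const_right _ _ tendsto_natCast_atTop_atTop)
  obtain ⟨k, hk1, hk2⟩ := ((hsmall.eventually_lt_const (by positivity : 0 < δ / 3)).and
    (Metric.tendsto_nhds.1 hlim (δ / 3) (by positivity))).exists
  filter_upwards [Metric.tendsto_nhds.1 (hmid k) (δ / 3) (by positivity), hB] with i hi hBi
  have h1 : dist (∫ p, F (a i) p ∂(ν i : Measure (ℝ × S)))
      (∫ p, FR k (a i) p ∂(ν i : Measure (ℝ × S))) < δ / 3 := by
    have hx : Integrable (fun p : ℝ × S => α * |p.1| + β) (ν i : Measure (ℝ × S)) := by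
      have hL : MemLp (fun p : ℝ × S => p.1) 2 (ν i : Measure (ℝ × S)) :=
        (memLp_two_iff_integrable_sq (by fun_prop)).2 hBi.1
      exact ((hL.integrable (by norm_num)).abs.const_mul α).add (integrable_const β)
    rw [dist_eq_norm, ← integral_sub
      (hx.mono' (hcont _).aestronglyMeasurable (Eventually.of_forall fun p => hFb _ p))
      (hx.mono' (hFRcont k _).aestronglyMeasurable (Eventually.of_forall fun p => hFRb k _ p))]
    refine (norm_integral_le_of_norm_le (hBi.1.const_mul (2 * (α + β) / (k + 1)))
      (Eventually.of_forall fun p => hdiff k (a i) p)).trans_lt ?_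
    rw [integral_const_mul]
    refine lt_of_le_of_lt ?_ hk1
    calc _ ≤ 2 * (α + β) / (k + 1) * |B| :=
          mul_le_mul_of_nonneg_left (hBi.2.trans (le_abs_self B)) (by positivity)
      _ = _ := by ring
  calc _ ≤ _ := dist_triangle4 _ (∫ p, FR k (a i) p ∂(ν i : Measure (ℝ × S)))
        (∫ p, FR k a₀ p ∂(ν₀ : Measure (ℝ × S))) _
    _ < δ / 3 + δ / 3 + δ / 3 := add_lt_add (add_lt_add h1 hi) hk2
    _ = δ := by ring

end Limits

/-! ### The limiting joint law of observations and standard deviations -/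

theorem normalExperiment_eq_map (π : ProbabilityMeasure ℝ) (s : ℝ) :
    normalExperiment π s = (normalExperiment π 1).map (Prod.map id fun e => s * e) := by
  have h : gaussianReal 0 (s ^ 2).toNNReal =
      (gaussianReal 0 ((1 : ℝ) ^ 2).toNNReal).map (fun e => s * e) := by
    rw [gaussianReal_map_const_mul]
    congr 1
    · simp
    · ext
      simp [Real.coe_toNNReal _ (sq_nonneg s)]
  rw [normalExperiment, h, normalExperiment, ← Measure.map_prod_map _ _ measurable_id (by fun_prop),
    Measure.map_id]

/-- Rescaling one standard noise realizes all noise levels on a single space, so mixing over `s` is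
a push-forward of a product measure. -/
theorem obsLaw_eq_map (π : ProbabilityMeasure ℝ) (s : ℝ) :
    obsLaw π s = (normalExperiment π 1).map (fun p => p.1 + s * p.2) := by
  rw [obsLaw, normalExperiment_eq_map π s, Measure.map_map (by fun_prop) (by fun_prop)]
  rfl

section LimitLaw

variable {c C : ℝ}

theorem measurable_scaled_sum :
    Measurable fun q : Set.Icc c C × (ℝ × ℝ) => (q.2.1 + q.1 * q.2.2, q.1) := by
  fun_prop

/-- The joint law of `(θ + s ζ, s)` with independent `θ ∼ π`, `ζ ∼ N(0, 1)` and `s ∼ Q`. -/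
noncomputable def limitLaw (π : ProbabilityMeasure ℝ) (Q : ProbabilityMeasure (Set.Icc c C)) :
    ProbabilityMeasure (ℝ × Set.Icc c C) :=
  ⟨((Q : Measure (Set.Icc c C)).prod (normalExperiment π 1)).map
    fun q : Set.Icc c C × (ℝ × ℝ) => (q.2.1 + q.1 * q.2.2, q.1),
    Measure.isProbabilityMeasure_map measurable_scaled_sum.aemeasurable⟩

theorem integral_limitLaw {G : Type*} [NormedAddCommGroup G] [NormedSpace ℝ G]
    (π : ProbabilityMeasure ℝ) (Q : ProbabilityMeasure (Set.Icc c C)) {f : ℝ × Set.Icc c C → G}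
    (hf : StronglyMeasurable f) (hint : Integrable f (limitLaw π Q : Measure (ℝ × Set.Icc c C))) :
    Integrable (fun s : Set.Icc c C => ∫ z, f (z, s) ∂(obsLaw π s)) (Q : Measure (Set.Icc c C)) ∧
    ∫ p, f p ∂(limitLaw π Q : Measure (ℝ × Set.Icc c C)) =
      ∫ s : Set.Icc c C, ∫ z, f (z, s) ∂(obsLaw π s) ∂(Q : Measure (Set.Icc c C)) := by
  have hmap : ∀ s : Set.Icc c C, ∫ z, f (z, s) ∂(obsLaw π s) =
      ∫ p : ℝ × ℝ, f (p.1 + s * p.2, s) ∂(normalExperiment π 1) := fun s => by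
    rw [obsLaw_eq_map, integral_map (by fun_prop)]
    exact (hf.comp_measurable (by fun_prop)).aestronglyMeasurable
  have hint' : Integrable (fun q : Set.Icc c C × (ℝ × ℝ) => f (q.2.1 + q.1 * q.2.2, q.1))
      ((Q : Measure (Set.Icc c C)).prod (normalExperiment π 1)) :=
    (integrable_map_measure hf.aestronglyMeasurable measurable_scaled_sum.aemeasurable).1 hint
  simp_rw [hmap]
  refine ⟨hint'.integral_prod_left, ?_⟩
  change ∫ p, f p ∂(Measure.map _ ((Q : Measure (Set.Icc c C)).prod (normalExperiment π 1))) = _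
  rw [integral_map measurable_scaled_sum.aemeasurable hf.aestronglyMeasurable,
    integral_prod _ hint']

theorem integrable_abs_limitLaw {M : ℝ} (μ : ProbabilityMeasure (Set.Icc (-M) M))
    (Q : ProbabilityMeasure (Set.Icc c C)) :
    Integrable (fun p : ℝ × Set.Icc c C => |p.1|) (limitLaw (extendLaw μ) Q : Measure (ℝ × Set.Icc c C)) := by
  change Integrable _ (Measure.map _ ((Q : Measure (Set.Icc c C)).prod (normalExperiment (extendLaw μ) 1)))
  rw [integrable_map_measure (by fun_prop) measurable_scaled_sum.aemeasurable]
  have h1 : Integrable (fun p : ℝ × ℝ => p.1) (normalExperiment (extendLaw μ) 1) :=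
    (memLp_two_fst μ 1).integrable (by norm_num)
  have h2 : Integrable (fun p : ℝ × ℝ => p.2) (normalExperiment (extendLaw μ) 1) := by
    have := ((memLp_two_obs μ 1).integrable (by norm_num)).sub h1
    simpa [Pi.sub_def] using this
  have h3 : Integrable (fun s : Set.Icc c C => (s : ℝ)) (Q : Measure (Set.Icc c C)) :=
    (BoundedContinuousFunction.mkOfCompact ⟨_, continuous_subtype_val⟩).integrable _
  exact ((h1.comp_snd (Q : Measure (Set.Icc c C))).add (h3.mul_prod h2)).abs

/-- The character of `ℝ × [c, C]` with frequencies `t` and `u`. -/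
noncomputable def char (t u : ℝ) (p : ℝ × Set.Icc c C) : ℂ :=
  Complex.exp (u * p.2 * Complex.I) * Complex.exp (t * p.1 * Complex.I)

theorem continuous_char (t u : ℝ) : Continuous (char (c := c) (C := C) t u) := by
  unfold char; fun_prop

theorem norm_char (t u : ℝ) (p : ℝ × Set.Icc c C) : ‖char t u p‖ = 1 := by
  rw [char, norm_mul, IsCorrelatedModel.norm_exp_mul_I, IsCorrelatedModel.norm_exp_mul_I, one_mul]

theorem norm_char_sub_le (t u x : ℝ) (s s' : Set.Icc c C) :
    ‖char t u (x, s) - char t u (x, s')‖ ≤ |u| * |(s : ℝ) - s'| := by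
  rw [char, char, ← sub_mul, norm_mul, IsCorrelatedModel.norm_exp_mul_I, mul_one, ← abs_mul]
  have : Complex.exp (u * s * Complex.I) - Complex.exp (u * s' * Complex.I) =
      Complex.exp (u * s' * Complex.I) *
        (Complex.exp (Complex.I * ((u * (s - s') : ℝ) : ℂ)) - 1) := by
    rw [mul_sub, ← Complex.exp_add, mul_one]
    congr 2
    push_cast
    ring
  rw [this, norm_mul, IsCorrelatedModel.norm_exp_mul_I, one_mul]
  exact Real.norm_exp_I_mul_ofReal_sub_one_le

theorem integral_char_limitLaw (π : ProbabilityMeasure ℝ) (Q : ProbabilityMeasure (Set.Icc c C))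
    (t u : ℝ) : ∫ p, char t u p ∂(limitLaw π Q : Measure (ℝ × Set.Icc c C)) =
      ∫ s : Set.Icc c C, Complex.exp (u * s * Complex.I) * charFun (obsLaw π s) t
        ∂(Q : Measure (Set.Icc c C)) := by
  rw [(integral_limitLaw π Q (continuous_char t u).stronglyMeasurable
    (Integrable.of_bound (C := 1) (continuous_char t u).aestronglyMeasurable
      (Eventually.of_forall fun p => (norm_char t u p).le))).2]
  refine integral_congr_ae (Eventually.of_forall fun s => ?_)
  simp only [char]
  rw [integral_const_mul, charFun_apply_real]

/-- Characters separate the laws on `ℝ × [c, C]`. -/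
theorem ext_of_integral_char {ν ν' : ProbabilityMeasure (ℝ × Set.Icc c C)}
    (h : ∀ t u, ∫ p, char t u p ∂(ν : Measure (ℝ × Set.Icc c C)) = ∫ p, char t u p ∂(ν' : Measure (ℝ × Set.Icc c C))) :
    ν = ν' := by
  -- Inside `ℝ × ℝ` every continuous linear functional `L` is given by the frequencies `L (1, 0)`
  -- and `L (0, 1)`, so the characters give the full characteristic function.
  have hj : MeasurableEmbedding (Prod.map id Subtype.val : ℝ × Set.Icc c C → ℝ × ℝ) :=
    (MeasurableEmbedding.id).prodMap (MeasurableEmbedding.subtype_coe measurableSet_Icc)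
  have key : (ν : Measure (ℝ × Set.Icc c C)).map (Prod.map id Subtype.val : _ → ℝ × ℝ) =
      (ν' : Measure (ℝ × Set.Icc c C)).map (Prod.map id Subtype.val : _ → ℝ × ℝ) := by
    have i1 := Measure.isProbabilityMeasure_map (μ := (ν : Measure (ℝ × Set.Icc c C)))
      hj.measurable.aemeasurable
    have i2 := Measure.isProbabilityMeasure_map (μ := (ν' : Measure (ℝ × Set.Icc c C)))
      hj.measurable.aemeasurable
    refine Measure.ext_of_charFunDual (funext fun L => ?_)
    rw [charFunDual_apply, charFunDual_apply, hj.integral_map, hj.integral_map]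
    have hL : ∀ p : ℝ × Set.Icc c C,
        Complex.exp (L (Prod.map id Subtype.val p) * Complex.I) = char (L (1, 0)) (L (0, 1)) p := by
      intro p
      have e : (Prod.map id Subtype.val p : ℝ × ℝ) =
          p.1 • ((1, 0) : ℝ × ℝ) + (p.2 : ℝ) • ((0, 1) : ℝ × ℝ) := by
        ext <;> simp
      rw [e, map_add, map_smul, map_smul, char, ← Complex.exp_add]
      congr 1
      push_cast [smul_eq_mul]
      ring
    simp_rw [hL]
    exact h _ _
  apply Subtype.ext
  have := congrArg (Measure.comap (Prod.map id Subtype.val : ℝ × Set.Icc c C → ℝ × ℝ)) key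
  rwa [hj.comap_map, hj.comap_map] at this

end LimitLaw

/-! ### Consistency along an ultrafilter -/

/-- The deterministic core. Along an ultrafilter the estimators, the empirical law of the `s` and
the empirical law of the pairs `(x, s')` all converge by compactness. The character averages
identify the last limit, and the likelihood bound then leaves `μ₀` as the only possible limit of the
estimators. -/
theorem tendsto_of_likelihood {ι : Type*} (𝒰 : Ultrafilter ι) {M c C : ℝ} (hM : 0 ≤ M)
    (hc : 0 < c) (N : ι → ℕ) (hN : ∀ i, 0 < N i) (x : ∀ i, Fin (N i) → ℝ)
    (s s' : ∀ i, Fin (N i) → Set.Icc c C) (μ : ι → ProbabilityMeasure (Set.Icc (-M) M))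
    (μ₀ : ProbabilityMeasure (Set.Icc (-M) M))
    (hD : ∀ t u : ℝ, Tendsto (fun i => (N i : ℂ)⁻¹ * ∑ k, Complex.exp (u * s i k * Complex.I) *
      (Complex.exp (t * x i k * Complex.I) - charFun (obsLaw (extendLaw μ₀) (s i k)) t))
      𝒰 (𝓝 0))
    {B : ℝ} (hB : ∀ᶠ i in (𝒰 : Filter ι), avg (fun k => x i k ^ 2) ≤ B)
    (hs : Tendsto (fun i => avg fun k => |(s' i k : ℝ) - s i k|) 𝒰 (𝓝 0))
    {r : ι → ℝ} (hr : Tendsto r 𝒰 (𝓝 0))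
    (hL : ∀ᶠ i in (𝒰 : Filter ι), -r i ≤ avg fun k => logRatio (μ i) μ₀ (x i k) (s' i k)) :
    Tendsto μ 𝒰 (𝓝 μ₀) := by
  obtain ⟨μ₁, -, hμ₁⟩ := isCompact_univ.ultrafilter_le_nhds (𝒰.map μ) (by simp)
  have hμ₁ : Tendsto μ 𝒰 (𝓝 μ₁) := hμ₁
  obtain ⟨Q, -, hQ⟩ := isCompact_univ.ultrafilter_le_nhds
    (𝒰.map fun i => empirical (hN i) (s i)) (by simp)
  have hQ : Tendsto (fun i => empirical (hN i) (s i)) 𝒰 (𝓝 Q) := hQ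
  set ν : ι → ProbabilityMeasure (ℝ × Set.Icc c C) :=
    fun i => empirical (hN i) fun k => (x i k, s' i k) with hν
  have hBν : ∀ᶠ i in (𝒰 : Filter ι), ν i ∈ secondMomentLe (Set.Icc c C) B := by
    filter_upwards [hB] with i hi
    refine ⟨integrable_empirical _ _ _, ?_⟩
    rw [hν, integral_empirical_eq_avg]
    exact hi
  obtain ⟨ν₁, -, hν₁⟩ := (isCompact_closure_secondMomentLe (S := Set.Icc c C) B).ultrafilter_le_nhds
    (𝒰.map ν) (le_principal_iff.2 (hBν.mono fun i hi => subset_closure hi))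
  have hν₁ : Tendsto ν 𝒰 (𝓝 ν₁) := hν₁
  -- The empirical character at `(x, s')` splits into the error of replacing `s'` by `s`, the
  -- centred average of `hD`, and an average of a continuous function of `s`, which converges to its
  -- integral under `Q`.
  have hident : ν₁ = limitLaw (extendLaw μ₀) Q := by
    refine ext_of_integral_char fun t u => ?_
    have h1 : Tendsto (fun i => ∫ p, char t u p ∂(ν i : Measure (ℝ × Set.Icc c C))) 𝒰
        (𝓝 (∫ p, char t u p ∂(ν₁ : Measure (ℝ × Set.Icc c C)))) :=
      (ProbabilityMeasure.tendsto_iff_forall_integral_rclike_tendsto ℂ).1 hν₁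
        (BoundedContinuousFunction.ofNormedAddCommGroup _ (continuous_char t u) 1
          fun p => (norm_char t u p).le)
    have hmc : Continuous fun σ : Set.Icc c C =>
        Complex.exp (u * σ * Complex.I) * charFun (obsLaw (extendLaw μ₀) σ) t := by
      simp_rw [charFun_obsLaw]
      fun_prop
    have h2 := (ProbabilityMeasure.tendsto_iff_forall_integral_rclike_tendsto ℂ).1 hQ
      (BoundedContinuousFunction.mkOfCompact ⟨_, hmc⟩)
    simp only [BoundedContinuousFunction.mkOfCompact_apply, ContinuousMap.coe_mk] at h2
    rw [integral_char_limitLaw]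
    refine tendsto_nhds_unique h1 ?_
    have h3 : Tendsto (fun i => (N i : ℂ)⁻¹ * ∑ k, (char t u (x i k, s' i k) -
        char t u (x i k, s i k))) 𝒰 (𝓝 0) := by
      refine squeeze_zero_norm (a := fun i => |u| * avg fun k => |(s' i k : ℝ) - s i k|)
        (fun i => ?_) (by simpa using hs.const_mul |u|)
      rw [norm_mul, norm_inv, Complex.norm_natCast, avg, one_div, mul_left_comm]
      refine mul_le_mul_of_nonneg_left ((norm_sum_le _ _).trans ?_) (by positivity)
      rw [Finset.mul_sum]
      exact Finset.sum_le_sum fun k _ => norm_char_sub_le t u _ _ _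
    have h4 := (h3.add (hD t u)).add h2
    rw [add_zero, zero_add] at h4
    refine h4.congr fun i => ?_
    rw [hν, integral_empirical, integral_empirical, ← mul_add, Complex.real_smul,
      Complex.real_smul]
    push_cast
    rw [← mul_add, ← Finset.sum_add_distrib, ← Finset.sum_add_distrib]
    congr 1
    refine Finset.sum_congr rfl fun k _ => ?_
    simp only [char]
    ring
  subst hident
  have hFc : Continuous (Function.uncurry
      fun (m : ProbabilityMeasure (Set.Icc (-M) M)) (p : ℝ × Set.Icc c C) =>
        logRatio m μ₀ p.1 p.2) :=
    (continuous_log_tiltMass hc).sub ((continuous_log_tiltMass hc).comp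
      (continuous_const.prodMk continuous_snd : Continuous
        fun q : ProbabilityMeasure (Set.Icc (-M) M) × (ℝ × Set.Icc c C) => (μ₀, q.2)))
  have hFb : ∀ (m : ProbabilityMeasure (Set.Icc (-M) M)) (p : ℝ × Set.Icc c C),
      |logRatio m μ₀ p.1 p.2| ≤ 2 * M / c ^ 2 * |p.1| + 2 * M ^ 2 / c ^ 2 := fun m p =>
    (abs_logRatio_le m μ₀ hc p.2.2.1).trans_eq (by ring)
  have habs := integrable_abs_limitLaw μ₀ Q
  -- The integrand depends on the moving estimator, so joint continuity in law and point is
  -- essential.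
  have hlim := tendsto_integral_of_linear_growth hFc (by positivity) (by positivity) hFb hμ₁ hν₁
    hBν habs
  have hnonneg : 0 ≤ ∫ p, logRatio μ₁ μ₀ p.1 p.2 ∂(limitLaw (extendLaw μ₀) Q : Measure (ℝ × Set.Icc c C)) := by
    have hr' := hr.neg
    rw [neg_zero] at hr'
    refine le_of_tendsto_of_tendsto hr' hlim ?_
    filter_upwards [hL] with i hi
    rw [hν, integral_empirical_eq_avg]
    exact hi
  have hFc1 : Continuous fun p : ℝ × Set.Icc c C => logRatio μ₁ μ₀ p.1 p.2 :=
    hFc.comp (continuous_const.prodMk continuous_id)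
  obtain ⟨hint, heq⟩ := integral_limitLaw (extendLaw μ₀) Q hFc1.stronglyMeasurable
    (((habs.const_mul _).add (integrable_const _)).mono' hFc1.aestronglyMeasurable
      (Eventually.of_forall fun p => hFb μ₁ p))
  rw [heq] at hnonneg
  by_cases hne : μ₁ = μ₀
  · rwa [hne] at hμ₁
  · exfalso
    have hneg : ∀ σ : Set.Icc c C, ∫ z, logRatio μ₁ μ₀ z σ ∂(obsLaw (extendLaw μ₀) σ) < 0 :=
      fun σ => integral_logRatio_neg hne (hc.trans_le σ.2.1)
    -- The divergence is positive at every noise level, hence on average under any `Q`; nothing more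
    -- about `Q` is needed.
    have hpos : 0 < ∫ σ : Set.Icc c C, -∫ z, logRatio μ₁ μ₀ z σ ∂(obsLaw (extendLaw μ₀) σ)
        ∂(Q : Measure (Set.Icc c C)) := by
      rw [integral_pos_iff_support_of_nonneg (fun σ => (neg_pos.2 (hneg σ)).le) hint.neg]
      have : Function.support (fun σ : Set.Icc c C =>
          -∫ z, logRatio μ₁ μ₀ z σ ∂(obsLaw (extendLaw μ₀) σ)) = Set.univ :=
        Set.eq_univ_of_forall fun σ => (neg_pos.2 (hneg σ)).ne'
      rw [this]
      simp
    rw [integral_neg] at hpos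
    linarith

/-! ### Moments and laws of large numbers in the correlated model -/

theorem avg_mono {n : ℕ} {a b : Fin n → ℝ} (h : ∀ i, a i ≤ b i) : avg a ≤ avg b :=
  mul_le_mul_of_nonneg_left (Finset.sum_le_sum fun i _ => h i) (by positivity)

theorem avg_nonneg {n : ℕ} {a : Fin n → ℝ} (h : ∀ i, 0 ≤ a i) : 0 ≤ avg a :=
  mul_nonneg (by positivity) (Finset.sum_nonneg fun i _ => h i)

/-- The sign condition on `b` covers `n = 0`, where the average is zero. -/
theorem avg_le_of_le {n : ℕ} {a : Fin n → ℝ} {b : ℝ} (hb : 0 ≤ b) (h : ∀ i, a i ≤ b) :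
    avg a ≤ b := by
  refine (avg_mono h).trans ?_
  rw [avg, Finset.sum_const, Finset.card_univ, Fintype.card_fin, nsmul_eq_mul, ← mul_assoc]
  refine mul_le_of_le_one_left hb ?_
  rw [one_div]
  exact inv_mul_le_one

theorem avg_sub {n : ℕ} (a b : Fin n → ℝ) : avg (fun i => a i - b i) = avg a - avg b := by
  simp only [avg, Finset.sum_sub_distrib, mul_sub]

theorem avg_add {n : ℕ} (a b : Fin n → ℝ) : avg (fun i => a i + b i) = avg a + avg b := by
  simp only [avg, Finset.sum_add_distrib, mul_add]

theorem avg_const_mul {n : ℕ} (r : ℝ) (a : Fin n → ℝ) : avg (fun i => r * a i) = r * avg a := by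
  simp only [avg, ← Finset.mul_sum, mul_left_comm]

theorem abs_avg_le {n : ℕ} (a : Fin n → ℝ) : |avg a| ≤ avg fun i => |a i| := by
  rw [avg, avg, abs_mul, abs_of_nonneg (by positivity : (0 : ℝ) ≤ 1 / n)]
  exact mul_le_mul_of_nonneg_left (Finset.abs_sum_le_sum_abs _ _) (by positivity)

theorem integral_avg {n : ℕ} {Ω : Type*} [MeasurableSpace Ω] {P : Measure Ω}
    {f : Fin n → Ω → ℝ} (hf : ∀ i, Integrable (f i) P) :
    ∫ ω, avg (fun i => f i ω) ∂P = avg fun i => ∫ ω, f i ω ∂P := by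
  simp only [avg]
  rw [integral_const_mul, integral_finsetSum _ fun i _ => hf i]

theorem integrable_avg {n : ℕ} {Ω : Type*} [MeasurableSpace Ω] {P : Measure Ω}
    {f : Fin n → Ω → ℝ} (hf : ∀ i, Integrable (f i) P) :
    Integrable (fun ω => avg fun i => f i ω) P :=
  (integrable_finsetSum _ fun i _ => hf i).const_mul _

theorem integral_sq_gaussianReal (v : NNReal) : ∫ x, x ^ 2 ∂(gaussianReal 0 v) = v := by
  have h := variance_id_gaussianReal (μ := 0) (v := v)
  rwa [variance_of_integral_eq_zero aemeasurable_id (by simp)] at h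

section Moments

variable {n : ℕ} {Ω : Type*} [MeasurableSpace Ω] {P : Measure Ω} [IsProbabilityMeasure P]
  {M : ℝ} {μ₀ : ProbabilityMeasure (Set.Icc (-M) M)} {Sig : Matrix (Fin n) (Fin n) ℝ}
  {σ : Fin n → ℝ} {θ ε X : Fin n → Ω → ℝ}

theorem IsCorrelatedModel.memLp_obs (h : IsCorrelatedModel P (extendLaw μ₀) Sig σ θ ε X)
    (i : Fin n) : MemLp (X i) 2 P := by
  have h1 : MemLp (fun p : ℝ × ℝ => p.1 + p.2) 2 (P.map fun ω => (θ i ω, ε i ω)) := by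
    rw [(h.hasLaw_pair i).map_eq]
    exact memLp_two_obs μ₀ (σ i)
  have h2 := (memLp_map_measure_iff h1.1 (h.hasLaw_pair i).aemeasurable).1 h1
  exact h2.ae_eq (Eventually.of_forall fun ω => (h.obs i ω).symm)

theorem IsCorrelatedModel.integral_sq_obs_le (h : IsCorrelatedModel P (extendLaw μ₀) Sig σ θ ε X)
    (i : Fin n) : ∫ ω, X i ω ^ 2 ∂P ≤ 2 * M ^ 2 + 2 * σ i ^ 2 := by
  have hθ : ∀ᵐ ω ∂P, θ i ω ∈ Set.Icc (-M) M := by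
    have := (h.law_signal i).map_eq ▸ ae_extendLaw μ₀
    exact ae_of_ae_map (h.law_signal i).aemeasurable this
  have hε2 : ∫ ω, ε i ω ^ 2 ∂P = σ i ^ 2 := by
    have e := integral_sq_gaussianReal (σ i ^ 2).toNNReal
    rw [← (h.hasLaw_noise i).map_eq, integral_map (h.hasLaw_noise i).aemeasurable
      (by fun_prop), Real.coe_toNNReal _ (sq_nonneg _)] at e
    exact e
  -- A non-integrable function has integral `0` by convention, which contradicts the value `σᵢ² > 0`
  -- just computed.
  have hεL : Integrable (fun ω => ε i ω ^ 2) P := by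
    by_contra hc
    rw [integral_undef hc] at hε2
    have := h.pos i
    nlinarith [sq_pos_of_pos this]
  calc ∫ ω, X i ω ^ 2 ∂P ≤ ∫ ω, (2 * M ^ 2 + 2 * ε i ω ^ 2) ∂P := by
        refine integral_mono_ae (h.memLp_obs i).integrable_sq
          ((integrable_const _).add (hεL.const_mul 2)) ?_
        filter_upwards [hθ] with ω hω
        have : θ i ω ^ 2 ≤ M ^ 2 := sq_le_sq' hω.1 hω.2
        rw [h.obs]
        nlinarith [sq_nonneg (θ i ω - ε i ω)]
    _ = _ := by
        rw [integral_add (integrable_const _) (hεL.const_mul 2), integral_const_mul 2 (fun ω => ε i ω ^ 2),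
          hε2]
        simp

theorem IsCorrelatedModel.measure_avg_sq_ge_le
    (h : IsCorrelatedModel P (extendLaw μ₀) Sig σ θ ε X) {C : ℝ} (hC : ∀ i, σ i ≤ C) {B : ℝ}
    (hB : 0 < B) :
    P {ω | B ≤ avg fun i => X i ω ^ 2} ≤ ENNReal.ofReal ((2 * M ^ 2 + 2 * C ^ 2) / B) := by
  have h1 := mul_meas_ge_le_integral_of_nonneg (μ := P)
    (Eventually.of_forall fun ω => avg_nonneg fun i => sq_nonneg (X i ω))
    (integrable_avg fun i => (h.memLp_obs i).integrable_sq) B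
  rw [integral_avg fun i => (h.memLp_obs i).integrable_sq] at h1
  have h2 : avg (fun i => ∫ ω, X i ω ^ 2 ∂P) ≤ 2 * M ^ 2 + 2 * C ^ 2 :=
    avg_le_of_le (by positivity) fun i => (h.integral_sq_obs_le i).trans (by
      have := pow_le_pow_left₀ (h.pos i).le (hC i) 2
      linarith)
  refine (ENNReal.le_ofReal_iff_toReal_le (measure_ne_top _ _) (by positivity)).2 ?_
  rw [le_div_iff₀ hB, mul_comm]
  exact h1.trans h2

end Moments

/-! ### Consistency of approximate maximum likelihood -/

section Consistency

variable {Ω : ℕ → Type*} [∀ n, MeasurableSpace (Ω n)] {P : ∀ n, Measure (Ω n)}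
  [∀ n, IsProbabilityMeasure (P n)] {M : ℝ} {μ₀ : ProbabilityMeasure (Set.Icc (-M) M)}
  {Sig : ∀ n : ℕ, Matrix (Fin n) (Fin n) ℝ} {σ : ∀ n, Fin n → ℝ}
  {θ ε X : ∀ n, Fin n → Ω n → ℝ}

theorem tendsto_average_centredChar
    (h : ∀ n, IsCorrelatedModel (P n) (extendLaw μ₀) (Sig n) (σ n) (θ n) (ε n) (X n))
    {C : ℝ} (hC0 : 0 ≤ C) (hC : ∀ n i, σ n i ≤ C)
    (hop : (fun n : ℕ => ‖Matrix.toEuclideanCLM (n := Fin n) (𝕜 := ℝ) (Sig n)‖)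
      =o[atTop] (fun n : ℕ => (n : ℝ))) (t u : ℝ) :
    Tendsto (fun z : Σ n, Ω n => (z.1 : ℂ)⁻¹ *
      ∑ i, IsCorrelatedModel.centredChar (extendLaw μ₀) (σ z.1) (X z.1) t u i z.2)
      (probFilter P) (𝓝 0) := by
  have hsq : Tendsto (fun z : Σ n, Ω n => ‖(z.1 : ℂ)⁻¹ *
      ∑ i, IsCorrelatedModel.centredChar (extendLaw μ₀) (σ z.1) (X z.1) t u i z.2‖ ^ 2)
      (probFilter P) (𝓝 0) := by
    refine tendsto_probFilter_of_integral (f := fun n ω => ‖(n : ℂ)⁻¹ *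
      ∑ i, IsCorrelatedModel.centredChar (extendLaw μ₀) (σ n) (X n) t u i ω‖ ^ 2)
      (fun n ω => sq_nonneg _) (fun n => ?_) ?_
    · have hm : AEStronglyMeasurable (fun ω => (n : ℂ)⁻¹ *
          ∑ i, IsCorrelatedModel.centredChar (extendLaw μ₀) (σ n) (X n) t u i ω) (P n) := by
        have := fun i => (h n).aestronglyMeasurable_centredChar t u i
        fun_prop
      refine Integrable.of_bound (C := (‖(n : ℂ)⁻¹‖ * ∑ _i : Fin n, 2) ^ 2) (hm.norm.pow 2)
        (Eventually.of_forall fun ω => ?_)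
      rw [norm_pow, norm_norm, norm_mul]
      gcongr
      exact (norm_sum_le _ _).trans
        (Finset.sum_le_sum fun i _ => IsCorrelatedModel.norm_centredChar_le t u i ω)
    · have hlim : Tendsto (fun n : ℕ => 4 * (n : ℝ)⁻¹ + t ^ 2 * (C *
          √(‖Matrix.toEuclideanCLM (n := Fin n) (𝕜 := ℝ) (Sig n)‖ / n))) atTop (𝓝 0) := by
        have h1 := (Real.continuous_sqrt.tendsto 0).comp hop.tendsto_div_nhds_zero
        rw [Real.sqrt_zero] at h1
        have h2 := (tendsto_inv_atTop_nhds_zero_nat (𝕜 := ℝ)).const_mul 4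
        simpa using h2.add ((h1.const_mul C).const_mul (t ^ 2))
      refine squeeze_zero' (Eventually.of_forall fun n => integral_nonneg fun ω => sq_nonneg _)
        ?_ hlim
      filter_upwards [eventually_gt_atTop 0] with n hn
      exact (h n).integral_norm_sq_average_le hn hC0 (hC n) t u
  rw [tendsto_zero_iff_norm_tendsto_zero]
  have := (Real.continuous_sqrt.tendsto 0).comp hsq
  simp only [Function.comp_def, Real.sqrt_sq (norm_nonneg _), Real.sqrt_zero] at this
  exact this

theorem log_mixDensity_sub (μ ν : ProbabilityMeasure (Set.Icc (-M) M)) (x : ℝ) {s : ℝ}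
    (hs : 0 < s) : Real.log (mixDensity (extendLaw μ) s x) -
      Real.log (mixDensity (extendLaw ν) s x) = logRatio μ ν x s := by
  rw [mixDensity_extendLaw, mixDensity_extendLaw,
    Real.log_mul (normalDensity_pos x hs).ne' (tiltMass_pos μ x hs).ne',
    Real.log_mul (normalDensity_pos x hs).ne' (tiltMass_pos ν x hs).ne', logRatio]
  ring

/-- Consistency of approximate maximum likelihood estimators of the mixing law. -/
theorem tendsto_clampLaw (hM : 0 ≤ M) (hMM : -M ≤ M)
    (h : ∀ n, IsCorrelatedModel (P n) (extendLaw μ₀) (Sig n) (σ n) (θ n) (ε n) (X n))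
    (hop : (fun n : ℕ => ‖Matrix.toEuclideanCLM (n := Fin n) (𝕜 := ℝ) (Sig n)‖)
      =o[atTop] (fun n : ℕ => (n : ℝ)))
    {πhat : ∀ n, Ω n → ProbabilityMeasure ℝ} {σhat : ∀ n, Fin n → Ω n → ℝ}
    (happ : ApproxOptimal P M (extendLaw μ₀) σ X πhat σhat) :
    Tendsto (fun z : Σ n, Ω n => clampLaw hMM (πhat z.1 z.2)) (probFilter P) (𝓝 μ₀) := by
  obtain ⟨c, C, hc, hC0, hb⟩ := happ.bounds
  obtain ⟨r, hr, hL⟩ := happ.likelihood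
  -- The bounds are vacuous at `n = 0`, so the inequality is read off at sample size one.
  have hcC : c ≤ C := (hb 1 0).1.1.trans (hb 1 0).1.2
  have hσC : ∀ n i, σ n i ≤ C := fun n i => (hb n i).1.2
  have hσhat := eventually_probFilter_of_ae (P := P)
    (p := fun n ω => ∀ i, c ≤ σhat n i ω ∧ σhat n i ω ≤ C) fun n =>
      ae_all_iff.2 fun i => (hb n i).2
  have hsupp := eventually_probFilter_of_ae happ.supported
  have hlik := eventually_probFilter_of_ae hL
  have hpos : ∀ᶠ z : Σ n, Ω n in probFilter P, 0 < z.1 :=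
    tendsto_fst_probFilter.eventually (eventually_gt_atTop 0)
  have hfst : Tendsto (fun z : Σ n, Ω n => r z.1) (probFilter P) (𝓝 0) :=
    hr.comp tendsto_fst_probFilter
  -- A fixed bound `B` on the empirical second moment need not hold with probability tending to one,
  -- so its failure is kept as an alternative. An ultrafilter decides between the two cases.
  have key : ∀ V ∈ 𝓝 μ₀, ∀ B : ℝ, {z : Σ n, Ω n | clampLaw hMM (πhat z.1 z.2) ∈ V ∨
      B ≤ avg fun i => X z.1 i z.2 ^ 2} ∈ probFilter P := by
    intro V hV B
    rw [Filter.mem_iff_ultrafilter]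
    intro 𝒰 h𝒰
    by_cases hB : ∀ᶠ z : Σ n, Ω n in (𝒰 : Filter _), avg (fun i => X z.1 i z.2 ^ 2) ≤ B
    · have hrange : Set.range (Subtype.val : {z : Σ n, Ω n // 0 < z.1} → _) ∈ 𝒰 := by
        filter_upwards [h𝒰 hpos] with z hz using ⟨⟨z, hz⟩, rfl⟩
      -- Empirical measures need a nonempty sample, so the ultrafilter is restricted to positive
      -- sample sizes.
      let 𝒱 : Ultrafilter {z : Σ n, Ω n // 0 < z.1} := 𝒰.comap Subtype.val_injective hrange
      have hval : Tendsto (Subtype.val : {z : Σ n, Ω n // 0 < z.1} → _) 𝒱 𝒰 := by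
        rw [Ultrafilter.coe_comap]
        exact tendsto_comap
      have hvalP := hval.mono_right h𝒰
      have hmain := tendsto_of_likelihood 𝒱 hM hc (fun z => z.1.1) (fun z => z.2)
        (fun z i => X z.1.1 i z.1.2) (fun z i => ⟨σ z.1.1 i, (hb _ i).1⟩)
        (fun z i => Set.projIcc c C hcC (σhat z.1.1 i z.1.2))
        (fun z => clampLaw hMM (πhat z.1.1 z.1.2)) μ₀
        (fun t u => (tendsto_average_centredChar h hC0.le hσC hop t u).comp hvalP)
        (hval.eventually hB) ?_ (hfst.comp hvalP) ?_
      · rw [Ultrafilter.coe_comap] at hmain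
        have : Tendsto (fun z : Σ n, Ω n => clampLaw hMM (πhat z.1 z.2)) 𝒰 (𝓝 μ₀) :=
          (tendsto_comap'_iff hrange).1 hmain
        filter_upwards [this hV] with z hz using Or.inl hz
      · refine ((tendstoInProb_iff.1 happ.variances).comp hvalP).congr' ?_
        filter_upwards [hvalP.eventually hσhat] with z hz
        simp only [Function.comp_apply]
        congr 1
        ext i
        rw [Set.projIcc_of_mem hcC (hz i)]
      · filter_upwards [hvalP.eventually hσhat, hvalP.eventually hsupp, hvalP.eventually hlik]
          with z h1 h2 h3
        have e : ∀ i, logRatio (clampLaw hMM (πhat z.1.1 z.1.2)) μ₀ (X z.1.1 i z.1.2)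
            (Set.projIcc c C hcC (σhat z.1.1 i z.1.2)) =
            Real.log (mixDensity (πhat z.1.1 z.1.2) (σhat z.1.1 i z.1.2) (X z.1.1 i z.1.2)) -
            Real.log (mixDensity (extendLaw μ₀) (σhat z.1.1 i z.1.2) (X z.1.1 i z.1.2)) := by
          intro i
          rw [Set.projIcc_of_mem hcC (h1 i), ← log_mixDensity_sub _ _ _ (hc.trans_le (h1 i).1),
            extendLaw_clampLaw hMM h2]
        simp_rw [e]
        rw [avg_sub]
        simp only [Function.comp_apply]
        linarith
    · rw [← Ultrafilter.eventually_not] at hB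
      filter_upwards [hB] with z hz using Or.inr (not_le.1 hz).le
  intro V hV
  rw [mem_map, mem_probFilter, ENNReal.tendsto_nhds_zero]
  intro δ hδ
  have hδ2 : 0 < δ / 2 := ENNReal.half_pos hδ.ne'
  have hB0 : Tendsto (fun B : ℝ => ENNReal.ofReal ((2 * M ^ 2 + 2 * C ^ 2) / B)) atTop (𝓝 0) := by
    have : Tendsto (fun B : ℝ => (2 * M ^ 2 + 2 * C ^ 2) / B) atTop (𝓝 0) :=
      tendsto_const_nhds.div_atTop tendsto_id
    simpa using ENNReal.tendsto_ofReal this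
  -- Markov's inequality makes the alternative of `key` improbable, uniformly in `n`, once `B` is
  -- large.
  obtain ⟨B, hB, hBpos⟩ := ((hB0.eventually_le_const hδ2).and (eventually_gt_atTop 0)).exists
  filter_upwards [ENNReal.tendsto_nhds_zero.1 (mem_probFilter.1 (key V hV B)) _ hδ2] with n hn
  refine (measure_mono (t := {ω | (⟨n, ω⟩ : Σ n, Ω n) ∉ {z : Σ n, Ω n |
    clampLaw hMM (πhat z.1 z.2) ∈ V ∨ B ≤ avg fun i => X z.1 i z.2 ^ 2}} ∪
    {ω | B ≤ avg fun i => X n i ω ^ 2}) fun ω hω => ?_).trans ((measure_union_le _ _).trans ?_)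
  · by_cases hω' : B ≤ avg fun i => X n i ω ^ 2
    · exact Or.inr hω'
    · exact Or.inl fun hc => hc.elim hω hω'
  · calc _ ≤ δ / 2 + δ / 2 :=
        add_le_add hn (((h n).measure_avg_sq_ge_le (hσC n) hBpos).trans hB)
      _ = δ := ENNReal.add_halves δ

end Consistency

/-! ### Hellinger consistency -/

theorem hellingerSq_nonneg (p q : ℝ → ℝ) : 0 ≤ hellingerSq p q :=
  mul_nonneg (by norm_num) (integral_nonneg fun _ => sq_nonneg _)

theorem sq_sqrt_sub_sqrt_le {a b : ℝ} (ha : 0 ≤ a) (hb : 0 ≤ b) : (√a - √b) ^ 2 ≤ a + b := by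
  have h1 := Real.sq_sqrt ha
  have h2 := Real.sq_sqrt hb
  nlinarith [mul_nonneg (Real.sqrt_nonneg a) (Real.sqrt_nonneg b)]

section Hellinger

variable {M c C : ℝ}

/-- An integrable envelope common to all mixing laws and noise levels, for dominated convergence in
the Hellinger integral. -/
theorem mixDensity_extendLaw_le (hc : 0 < c) (μ : ProbabilityMeasure (Set.Icc (-M) M)) (x : ℝ)
    (s : Set.Icc c C) : mixDensity (extendLaw μ) s x ≤
      (√(2 * Real.pi * c ^ 2))⁻¹ * Real.exp (M ^ 2 / c ^ 2 + M ^ 2 * C ^ 2 / c ^ 4) *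
        Real.exp (-(1 / (4 * C ^ 2)) * x ^ 2) := by
  have hs : 0 < (s : ℝ) := hc.trans_le s.2.1
  have hC : 0 < C := hs.trans_le s.2.2
  -- Completing the square: the linear term costs half of the Gaussian exponent `x² / (2 C²)`, and
  -- the other half remains.
  have hM : M * |x| / c ^ 2 ≤ M ^ 2 * C ^ 2 / c ^ 4 + x ^ 2 / (4 * C ^ 2) := by
    have h := sq_nonneg (M * C / c ^ 2 - |x| / (2 * C))
    have e : (M * C / c ^ 2 - |x| / (2 * C)) ^ 2 =
        M ^ 2 * C ^ 2 / c ^ 4 + |x| ^ 2 / (4 * C ^ 2) - M * |x| / c ^ 2 := by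
      field_simp; ring
    rw [e, sq_abs] at h
    linarith
  rw [mixDensity_extendLaw, normalDensity_eq]
  calc _ ≤ (√(2 * Real.pi * c ^ 2))⁻¹ * Real.exp (-x ^ 2 / (2 * C ^ 2)) *
        Real.exp ((M * |x| + M ^ 2) / c ^ 2) := by
        refine mul_le_mul (mul_le_mul ?_ ?_ (Real.exp_pos _).le (by positivity))
          (tiltMass_bounds μ hc s.2.1).2 (tiltMass_pos μ x hs).le (by positivity)
        · have := s.2.1
          gcongr
        · refine Real.exp_le_exp.2 ?_
          rw [neg_div, neg_div, neg_le_neg_iff]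
          have := s.2.2
          gcongr
    _ = (√(2 * Real.pi * c ^ 2))⁻¹ *
        Real.exp (-x ^ 2 / (2 * C ^ 2) + (M * |x| + M ^ 2) / c ^ 2) := by
        rw [Real.exp_add]; ring
    _ ≤ (√(2 * Real.pi * c ^ 2))⁻¹ * Real.exp ((M ^ 2 / c ^ 2 + M ^ 2 * C ^ 2 / c ^ 4) +
        (-(1 / (4 * C ^ 2)) * x ^ 2)) := by
        refine mul_le_mul_of_nonneg_left (Real.exp_le_exp.2 ?_) (by positivity)
        have e1 : -x ^ 2 / (2 * C ^ 2) = -(2 * (x ^ 2 / (4 * C ^ 2))) := by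
          field_simp; ring
        have e2 : -(1 / (4 * C ^ 2)) * x ^ 2 = -(x ^ 2 / (4 * C ^ 2)) := by ring
        rw [e1, e2, add_div]
        linarith
    _ = _ := by rw [Real.exp_add]; ring

theorem continuous_hellingerSq (hc : 0 < c) (hcC : c ≤ C)
    (μ₀ : ProbabilityMeasure (Set.Icc (-M) M)) :
    Continuous fun p : ProbabilityMeasure (Set.Icc (-M) M) × Set.Icc c C =>
      hellingerSq (mixDensity (extendLaw p.1) p.2) (mixDensity (extendLaw μ₀) p.2) := by
  have hC : 0 < C := hc.trans_le hcC
  refine Continuous.mul continuous_const ?_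
  have hmix := continuous_mixDensity_extendLaw (M := M) (C := C) hc
  refine continuous_of_dominated (bound := fun x => 2 * ((√(2 * Real.pi * c ^ 2))⁻¹ *
      Real.exp (M ^ 2 / c ^ 2 + M ^ 2 * C ^ 2 / c ^ 4) *
        Real.exp (-(1 / (4 * C ^ 2)) * x ^ 2))) (fun p => ?_)
    (fun p => Eventually.of_forall fun x => ?_) ?_ (Eventually.of_forall fun x => ?_)
  · exact (((measurable_mixDensity _ _).sqrt.sub (measurable_mixDensity _ _).sqrt).pow_const
      2).aestronglyMeasurable
  · rw [Real.norm_eq_abs, abs_of_nonneg (sq_nonneg _), two_mul]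
    exact (sq_sqrt_sub_sqrt_le (mixDensity_nonneg _ _ _) (mixDensity_nonneg _ _ _)).trans
      (add_le_add (mixDensity_extendLaw_le hc _ x _) (mixDensity_extendLaw_le hc _ x _))
  · exact ((integrable_exp_neg_mul_sq (by positivity)).const_mul _).const_mul _
  · have h1 : Continuous fun p : ProbabilityMeasure (Set.Icc (-M) M) × Set.Icc c C =>
        mixDensity (extendLaw p.1) p.2 x :=
      hmix.comp (continuous_fst.prodMk (continuous_const.prodMk continuous_snd))
    have h2 : Continuous fun p : ProbabilityMeasure (Set.Icc (-M) M) × Set.Icc c C =>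
        mixDensity (extendLaw μ₀) p.2 x :=
      hmix.comp (continuous_const.prodMk (continuous_const.prodMk continuous_snd))
    exact (h1.sqrt.sub h2.sqrt).pow 2

end Hellinger

/-- The tube lemma, giving uniformity over noise levels and bounded observations. -/
theorem eventually_forall_abs_lt {A Z : Type*} [TopologicalSpace A] [TopologicalSpace Z]
    {K : Set Z} (hK : IsCompact K) {F : A × Z → ℝ} (hF : Continuous F) {a₀ : A}
    (h0 : ∀ z ∈ K, F (a₀, z) = 0) {δ : ℝ} (hδ : 0 < δ) :
    ∀ᶠ a in 𝓝 a₀, ∀ z ∈ K, |F (a, z)| < δ :=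
  hK.eventually_forall_of_forall_eventually fun z hz =>
    hF.abs.continuousAt.eventually_lt continuousAt_const (by simpa [h0 z hz] using hδ)

theorem tendstoInProb_hellinger {Ω : ℕ → Type*} [∀ n, MeasurableSpace (Ω n)]
    {P : ∀ n, Measure (Ω n)} {M c C : ℝ} {μ₀ : ProbabilityMeasure (Set.Icc (-M) M)}
    (hMM : -M ≤ M) (hc : 0 < c) (hcC : c ≤ C) {σ : ∀ n, Fin n → ℝ}
    (hσ : ∀ n i, σ n i ∈ Set.Icc c C) {πhat : ∀ n, Ω n → ProbabilityMeasure ℝ}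
    (hsupp : ∀ n, ∀ᵐ ω ∂(P n), SupportedIn M (πhat n ω))
    (hlim : Tendsto (fun z : Σ n, Ω n => clampLaw hMM (πhat z.1 z.2)) (probFilter P) (𝓝 μ₀)) :
    TendstoInProb P (fun n ω => avg fun i => hellingerSq (mixDensity (πhat n ω) (σ n i))
      (mixDensity (extendLaw μ₀) (σ n i))) 0 := by
  rw [tendstoInProb_iff, Metric.tendsto_nhds]
  intro δ hδ
  have h0 : ∀ s ∈ (Set.univ : Set (Set.Icc c C)),
      hellingerSq (mixDensity (extendLaw μ₀) s) (mixDensity (extendLaw μ₀) s) = 0 := fun s _ => by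
    simp [hellingerSq]
  have h1 := eventually_forall_abs_lt isCompact_univ (continuous_hellingerSq hc hcC μ₀) h0
    (half_pos hδ)
  filter_upwards [hlim.eventually h1, eventually_probFilter_of_ae hsupp] with z hz hs
  rw [extendLaw_clampLaw hMM hs] at hz
  rw [dist_zero_right, Real.norm_eq_abs, abs_of_nonneg (avg_nonneg fun i => hellingerSq_nonneg _ _)]
  refine lt_of_le_of_lt (avg_le_of_le (half_pos hδ).le fun i => ?_) (half_lt_self hδ)
  exact (le_abs_self _).trans (hz ⟨σ z.1 i, hσ z.1 i⟩ trivial).le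

/-! ### The regret -/

theorem measurable_normalDensity : Measurable fun p : ℝ × ℝ => normalDensity p.1 p.2 := by
  simp_rw [normalDensity_eq]
  fun_prop

/-- A measurable random law is a Markov kernel, and integrals of jointly measurable functions
against a kernel are measurable. -/
theorem measurable_postMean_comp {Ω : Type*} [MeasurableSpace Ω]
    {πhat : Ω → ProbabilityMeasure ℝ} (hπ : Measurable fun ω => (πhat ω : Measure ℝ))
    {X s : Ω → ℝ} (hX : Measurable X) (hs : Measurable s) :
    Measurable fun ω => postMean (πhat ω) (X ω) (s ω) := by
  let κ : Kernel Ω ℝ := ⟨fun ω => (πhat ω : Measure ℝ), hπ⟩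
  have : IsMarkovKernel κ := ⟨fun ω => inferInstanceAs (IsProbabilityMeasure (πhat ω : Measure ℝ))⟩
  have hd : Measurable fun p : Ω × ℝ => normalDensity (X p.1 - p.2) (s p.1) :=
    measurable_normalDensity.comp
      (((hX.comp measurable_fst).sub measurable_snd).prodMk (hs.comp measurable_fst))
  have h1 : StronglyMeasurable fun ω => ∫ t, t * normalDensity (X ω - t) (s ω) ∂(κ ω) :=
    (measurable_snd.mul hd : Measurable fun p : Ω × ℝ =>
      p.2 * normalDensity (X p.1 - p.2) (s p.1)).stronglyMeasurable.integral_kernel_prod_right'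
  have h2 : StronglyMeasurable fun ω => ∫ t, normalDensity (X ω - t) (s ω) ∂(κ ω) :=
    hd.stronglyMeasurable.integral_kernel_prod_right'
  exact h1.measurable.div h2.measurable

theorem aemeasurable_postMean_comp {Ω : Type*} [MeasurableSpace Ω] {P : Measure Ω}
    {πhat : Ω → ProbabilityMeasure ℝ} (hπ : Measurable fun ω => (πhat ω : Measure ℝ))
    {X s : Ω → ℝ} (hX : AEMeasurable X P) (hs : Measurable s) :
    AEMeasurable (fun ω => postMean (πhat ω) (X ω) (s ω)) P :=
  ⟨_, measurable_postMean_comp hπ hX.measurable_mk hs, by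
    filter_upwards [hX.ae_eq_mk] with ω hω
    rw [hω]⟩

/-- Posterior means are equicontinuous in the mixing law and the standard deviation over
compact sets of observations. -/
theorem eventually_abs_postMean_sub_le {M c C : ℝ} (hc : 0 < c)
    (μ₀ : ProbabilityMeasure (Set.Icc (-M) M)) (R : ℝ) {δ : ℝ} (hδ : 0 < δ) :
    ∃ γ > 0, ∀ᶠ μ in 𝓝 μ₀, ∀ x ∈ Set.Icc (-R) R, ∀ s s' : Set.Icc c C,
      |(s : ℝ) - s'| < γ →
      |postMean (extendLaw μ) x s - postMean (extendLaw μ₀) x s'| ≤ 2 * δ := by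
  have hcont := continuous_postMean_extendLaw (M := M) (C := C) hc
  have hcont₀ : Continuous fun z : ℝ × Set.Icc c C => postMean (extendLaw μ₀) z.1 z.2 :=
    hcont.comp (continuous_const.prodMk continuous_id)
  have hK : IsCompact (Set.Icc (-R) R ×ˢ (Set.univ : Set (Set.Icc c C))) :=
    isCompact_Icc.prod isCompact_univ
  obtain ⟨γ, hγ, hu⟩ := Metric.uniformContinuousOn_iff.1
    (hK.uniformContinuousOn_of_continuous hcont₀.continuousOn) δ hδ
  refine ⟨γ, hγ, ?_⟩
  filter_upwards [eventually_forall_abs_lt hK (hcont.sub (hcont₀.comp continuous_snd))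
    (a₀ := μ₀) (fun z _ => by simp) hδ] with μ hμ x hx s s' hss
  have h1 : |postMean (extendLaw μ) x s - postMean (extendLaw μ₀) x s| < δ :=
    hμ (x, s) ⟨hx, trivial⟩
  have h2 := hu (x, s) ⟨hx, trivial⟩ (x, s') ⟨hx, trivial⟩ (by
    rw [dist_prod_same_left, Subtype.dist_eq, Real.dist_eq]; exact hss)
  rw [Real.dist_eq] at h2
  have h3 := abs_sub_le (postMean (extendLaw μ) x s) (postMean (extendLaw μ₀) x s)
    (postMean (extendLaw μ₀) x s')
  linarith

/-- Passes from mean squared errors to their roots without a positive lower bound on the oracle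
risk. -/
theorem abs_sqrt_sub_sqrt_le {a b : ℝ} (ha : 0 ≤ a) (hb : 0 ≤ b) : |√a - √b| ≤ √|a - b| := by
  refine Real.le_sqrt_of_sq_le ?_
  rw [sq_abs]
  have h1 := Real.sq_sqrt ha
  have h2 := Real.sq_sqrt hb
  have h3 := Real.sqrt_nonneg a
  have h4 := Real.sqrt_nonneg b
  rcases le_total (√a) (√b) with h | h
  · have := neg_abs_le (a - b)
    nlinarith
  · have := le_abs_self (a - b)
    nlinarith

section Regret

variable {Ω : ℕ → Type*} [∀ n, MeasurableSpace (Ω n)] {P : ∀ n, Measure (Ω n)}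
  {M : ℝ} {μ₀ : ProbabilityMeasure (Set.Icc (-M) M)}
  {Sig : ∀ n : ℕ, Matrix (Fin n) (Fin n) ℝ} {σ : ∀ n, Fin n → ℝ}
  {θ ε X : ∀ n, Fin n → Ω n → ℝ}

/-- Bound for the average deviation of plug-in posterior means from oracle posterior means. -/
theorem eventually_avg_postMean_le {c C : ℝ} (hM : 0 ≤ M) (hMM : -M ≤ M) (hc : 0 < c)
    (hσ : ∀ n i, σ n i ∈ Set.Icc c C)
    {πhat : ∀ n, Ω n → ProbabilityMeasure ℝ} {σhat : ∀ n, Fin n → Ω n → ℝ}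
    (hσhat : ∀ᶠ z : Σ n, Ω n in probFilter P, ∀ i, σhat z.1 i z.2 ∈ Set.Icc c C)
    (hsupp : ∀ᶠ z : Σ n, Ω n in probFilter P, SupportedIn M (πhat z.1 z.2))
    (hvar : TendstoInProb P (fun n ω => avg fun i => |σhat n i ω - σ n i|) 0)
    (hlim : Tendsto (fun z : Σ n, Ω n => clampLaw hMM (πhat z.1 z.2)) (probFilter P) (𝓝 μ₀))
    {R : ℝ} (hR : 0 < R) {δ : ℝ} (hδ : 0 < δ) :
    ∀ᶠ z : Σ n, Ω n in probFilter P,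
      avg (fun i => |postMean (πhat z.1 z.2) (X z.1 i z.2) (σhat z.1 i z.2) -
        postMean (extendLaw μ₀) (X z.1 i z.2) (σ z.1 i)|) ≤
      3 * δ + 2 * M / R ^ 2 * avg fun i => X z.1 i z.2 ^ 2 := by
  obtain ⟨γ, hγ, hV⟩ := eventually_abs_postMean_sub_le (C := C) hc μ₀ R hδ
  have hsmall : Tendsto (fun z : Σ n, Ω n =>
      2 * M / γ * avg fun i => |σhat z.1 i z.2 - σ z.1 i|) (probFilter P) (𝓝 0) := by
    simpa using (tendstoInProb_iff.1 hvar).const_mul (2 * M / γ)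
  filter_upwards [hσhat, hsupp, hlim.eventually hV, hsmall.eventually_le_const hδ]
    with z h1 h2 h3 h4
  -- Where `σ̂ᵢ` is off by at least `γ` or `|Xᵢ| > R`, the trivial bound `2 M` is multiplied by
  -- `|σ̂ᵢ - σᵢ| / γ` or `Xᵢ² / R²`, which is then at least one.
  have key : ∀ i, |postMean (πhat z.1 z.2) (X z.1 i z.2) (σhat z.1 i z.2) -
        postMean (extendLaw μ₀) (X z.1 i z.2) (σ z.1 i)| ≤
      2 * δ + (2 * M / γ * |σhat z.1 i z.2 - σ z.1 i| + 2 * M / R ^ 2 * X z.1 i z.2 ^ 2) := by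
    intro i
    rw [← extendLaw_clampLaw hMM h2]
    have hA : 0 ≤ 2 * M / γ * |σhat z.1 i z.2 - σ z.1 i| := by positivity
    have hB : 0 ≤ 2 * M / R ^ 2 * X z.1 i z.2 ^ 2 := by positivity
    have htriv : |postMean (extendLaw (clampLaw hMM (πhat z.1 z.2))) (X z.1 i z.2) (σhat z.1 i z.2)
        - postMean (extendLaw μ₀) (X z.1 i z.2) (σ z.1 i)| ≤ 2 * M := by
      refine (abs_sub _ _).trans ?_
      linarith [abs_postMean_extendLaw_le (clampLaw hMM (πhat z.1 z.2)) (X z.1 i z.2)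
        (hc.trans_le (h1 i).1), abs_postMean_extendLaw_le μ₀ (X z.1 i z.2)
        (hc.trans_le (hσ z.1 i).1)]
    by_cases hx : X z.1 i z.2 ∈ Set.Icc (-R) R
    · by_cases hs : |σhat z.1 i z.2 - σ z.1 i| < γ
      · have := h3 _ hx ⟨_, h1 i⟩ ⟨_, hσ z.1 i⟩ hs
        linarith
      · have : 2 * M ≤ 2 * M / γ * |σhat z.1 i z.2 - σ z.1 i| := by
          rw [div_mul_eq_mul_div, le_div_iff₀ hγ]
          exact mul_le_mul_of_nonneg_left (not_lt.1 hs) (by positivity)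
        linarith
    · have hx' : R ^ 2 ≤ X z.1 i z.2 ^ 2 := by
        rw [← sq_abs (X z.1 i z.2)]
        exact pow_le_pow_left₀ hR.le (not_le.1 fun h => hx (abs_le.1 h)).le 2
      have : 2 * M ≤ 2 * M / R ^ 2 * X z.1 i z.2 ^ 2 := by
        rw [div_mul_eq_mul_div, le_div_iff₀ (by positivity)]
        exact mul_le_mul_of_nonneg_left hx' (by positivity)
      linarith
  refine (avg_mono key).trans ?_
  rw [avg_add, avg_add, avg_const_mul (2 * M / γ), avg_const_mul (2 * M / R ^ 2)]
  have : avg (fun _ : Fin z.1 => 2 * δ) ≤ 2 * δ := avg_le_of_le (by positivity) fun _ => le_rfl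
  linarith

variable [∀ n, IsProbabilityMeasure (P n)]

/-- Posterior means are bounded by `M`, so convergence in probability upgrades to convergence in
mean: the exceptional event costs at most `2 M` times its probability, and large observations are
paid for by second moments. -/
theorem tendsto_avg_integral_postMean {c C : ℝ} (hM : 0 ≤ M) (hMM : -M ≤ M) (hc : 0 < c)
    (hσ : ∀ n i, σ n i ∈ Set.Icc c C)
    (h : ∀ n, IsCorrelatedModel (P n) (extendLaw μ₀) (Sig n) (σ n) (θ n) (ε n) (X n))
    {πhat : ∀ n, Ω n → ProbabilityMeasure ℝ} {σhat : ∀ n, Fin n → Ω n → ℝ}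
    (hσhat : ∀ n, ∀ᵐ ω ∂(P n), ∀ i, σhat n i ω ∈ Set.Icc c C)
    (hsupp : ∀ n, ∀ᵐ ω ∂(P n), SupportedIn M (πhat n ω))
    (hvar : TendstoInProb P (fun n ω => avg fun i => |σhat n i ω - σ n i|) 0)
    (hlim : Tendsto (fun z : Σ n, Ω n => clampLaw hMM (πhat z.1 z.2)) (probFilter P) (𝓝 μ₀))
    (hint : ∀ n i, Integrable (fun ω => |postMean (πhat n ω) (X n i ω) (σhat n i ω) -
        postMean (extendLaw μ₀) (X n i ω) (σ n i)|) (P n)) :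
    Tendsto (fun n => ∫ ω, avg (fun i => |postMean (πhat n ω) (X n i ω) (σhat n i ω) -
        postMean (extendLaw μ₀) (X n i ω) (σ n i)|) ∂(P n)) atTop (𝓝 0) := by
  rw [Metric.tendsto_nhds]
  intro δ hδ
  have hR0 : Tendsto (fun R : ℝ => 2 * M * (2 * M ^ 2 + 2 * C ^ 2) / R ^ 2) atTop (𝓝 0) :=
    tendsto_const_nhds.div_atTop (tendsto_pow_atTop two_ne_zero)
  obtain ⟨R, hRδ, hR⟩ := ((hR0.eventually_lt_const (by positivity : 0 < δ / 3)).and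
    (eventually_gt_atTop 0)).exists
  have hmem := eventually_avg_postMean_le (X := X) hM hMM hc hσ
    (eventually_probFilter_of_ae hσhat) (eventually_probFilter_of_ae hsupp) hvar hlim hR
    (by positivity : 0 < δ / 9)
  have hbad : Tendsto (fun n => 2 * M * (P n).real {ω | (⟨n, ω⟩ : Σ n, Ω n) ∉ {z : Σ n, Ω n |
      avg (fun i => |postMean (πhat z.1 z.2) (X z.1 i z.2) (σhat z.1 i z.2) -
        postMean (extendLaw μ₀) (X z.1 i z.2) (σ z.1 i)|) ≤
      3 * (δ / 9) + 2 * M / R ^ 2 * avg fun i => X z.1 i z.2 ^ 2}}) atTop (𝓝 0) := by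
    have := (ENNReal.tendsto_toReal ENNReal.zero_ne_top).comp (mem_probFilter.1 hmem)
    simpa [Measure.real, Function.comp_def] using this.const_mul (2 * M)
  filter_upwards [hbad.eventually_lt_const (by positivity : 0 < δ / 3)] with n hn
  set g : Ω n → ℝ := fun ω => avg (fun i => |postMean (πhat n ω) (X n i ω) (σhat n i ω) -
        postMean (extendLaw μ₀) (X n i ω) (σ n i)|) with hg
  set A : Set (Ω n) := {ω | (⟨n, ω⟩ : Σ n, Ω n) ∉ {z : Σ n, Ω n |
      avg (fun i => |postMean (πhat z.1 z.2) (X z.1 i z.2) (σhat z.1 i z.2) -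
        postMean (extendLaw μ₀) (X z.1 i z.2) (σ z.1 i)|) ≤
      3 * (δ / 9) + 2 * M / R ^ 2 * avg fun i => X z.1 i z.2 ^ 2}} with hA
  have hg0 : ∀ ω, 0 ≤ g ω := fun ω => avg_nonneg fun i => abs_nonneg _
  rw [dist_zero_right, Real.norm_eq_abs, abs_of_nonneg (integral_nonneg hg0)]
  have hXint : Integrable (fun ω => avg fun i => X n i ω ^ 2) (P n) :=
    integrable_avg fun i => ((h n).memLp_obs i).integrable_sq
  -- The exceptional event is not known to be measurable; its measurable hull has the same
  -- probability.
  have hind : Integrable ((toMeasurable (P n) A).indicator fun _ => 2 * M) (P n) :=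
    (integrable_const _).indicator (measurableSet_toMeasurable _ _)
  have hle : ∀ᵐ ω ∂(P n), g ω ≤ (3 * (δ / 9) + 2 * M / R ^ 2 * avg fun i => X n i ω ^ 2) +
      (toMeasurable (P n) A).indicator (fun _ => 2 * M) ω := by
    filter_upwards [hσhat n, hsupp n] with ω h1 h2
    by_cases hω : ω ∈ A
    · rw [Set.indicator_of_mem (subset_toMeasurable _ _ hω)]
      have h3 : g ω ≤ 2 * M := by
        refine avg_le_of_le (by positivity) fun i => (abs_sub _ _).trans ?_
        rw [← extendLaw_clampLaw hMM h2]
        linarith [abs_postMean_extendLaw_le (clampLaw hMM (πhat n ω)) (X n i ω)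
          (hc.trans_le (h1 i).1), abs_postMean_extendLaw_le μ₀ (X n i ω)
          (hc.trans_le (hσ n i).1)]
      have h4 : 0 ≤ 2 * M / R ^ 2 * avg fun i => X n i ω ^ 2 :=
        mul_nonneg (by positivity) (avg_nonneg fun i => sq_nonneg _)
      linarith
    · have h3 : g ω ≤ 3 * (δ / 9) + 2 * M / R ^ 2 * avg fun i => X n i ω ^ 2 := not_not.1 hω
      have h4 : 0 ≤ (toMeasurable (P n) A).indicator (fun _ => 2 * M) ω :=
        Set.indicator_nonneg (fun _ _ => by positivity) _
      linarith
  have hdom : Integrable (fun ω => 3 * (δ / 9) + 2 * M / R ^ 2 * avg fun i => X n i ω ^ 2) (P n) :=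
    (integrable_const _).add (hXint.const_mul _)
  have hmain := integral_mono_ae (integrable_avg (hint n)) (hdom.add hind) hle
  have hX2 : ∫ ω, avg (fun i => X n i ω ^ 2) ∂(P n) ≤ 2 * M ^ 2 + 2 * C ^ 2 := by
    rw [integral_avg fun i => ((h n).memLp_obs i).integrable_sq]
    refine avg_le_of_le (by positivity) fun i => ((h n).integral_sq_obs_le i).trans ?_
    have := pow_le_pow_left₀ ((h n).pos i).le (hσ n i).2 2
    linarith
  have hval : ∫ ω, ((3 * (δ / 9) + 2 * M / R ^ 2 * avg fun i => X n i ω ^ 2) +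
      (toMeasurable (P n) A).indicator (fun _ => 2 * M) ω) ∂(P n) =
      3 * (δ / 9) + 2 * M / R ^ 2 * (∫ ω, avg (fun i => X n i ω ^ 2) ∂(P n)) +
        2 * M * (P n).real A := by
    rw [integral_add hdom hind,
      integral_add (integrable_const _) (hXint.const_mul _),
      integral_const_mul (2 * M / R ^ 2) (fun ω => avg fun i => X n i ω ^ 2),
      integral_indicator (measurableSet_toMeasurable _ _)]
    simp [Measure.real, mul_comm]
  have h5 : 2 * M / R ^ 2 * (∫ ω, avg (fun i => X n i ω ^ 2) ∂(P n)) < δ / 3 := by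
    refine lt_of_le_of_lt (mul_le_mul_of_nonneg_left hX2 (by positivity)) ?_
    rwa [div_mul_eq_mul_div]
  change ∫ ω, g ω ∂(P n) ≤ ∫ ω, ((3 * (δ / 9) + 2 * M / R ^ 2 * avg fun i => X n i ω ^ 2) +
      (toMeasurable (P n) A).indicator (fun _ => 2 * M) ω) ∂(P n) at hmain
  rw [hval] at hmain
  have hn' : 2 * M * (P n).real A < δ / 3 := hn
  change ∫ ω, g ω ∂(P n) < δ
  linarith

theorem tendsto_regret {c C : ℝ} (hM : 0 ≤ M) (hMM : -M ≤ M) (hc : 0 < c)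
    (hσ : ∀ n i, σ n i ∈ Set.Icc c C)
    (h : ∀ n, IsCorrelatedModel (P n) (extendLaw μ₀) (Sig n) (σ n) (θ n) (ε n) (X n))
    {πhat : ∀ n, Ω n → ProbabilityMeasure ℝ}
    (hπhat : ∀ n, Measurable fun ω => (πhat n ω : Measure ℝ)) {σhat : ∀ n, Fin n → Ω n → ℝ}
    (hσm : ∀ n i, Measurable (σhat n i))
    (hσhat : ∀ n, ∀ᵐ ω ∂(P n), ∀ i, σhat n i ω ∈ Set.Icc c C)
    (hsupp : ∀ n, ∀ᵐ ω ∂(P n), SupportedIn M (πhat n ω))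
    (hvar : TendstoInProb P (fun n ω => avg fun i => |σhat n i ω - σ n i|) 0)
    (hlim : Tendsto (fun z : Σ n, Ω n => clampLaw hMM (πhat z.1 z.2)) (probFilter P) (𝓝 μ₀)) :
    Tendsto (fun n => regret (P n) (extendLaw μ₀) (σ n) (θ n) (X n) (πhat n) (σhat n))
      atTop (𝓝 0) := by
  have hs : ∀ n i, 0 < σ n i := fun n i => hc.trans_le (hσ n i).1
  have mθ : ∀ n i, AEStronglyMeasurable (θ n i) (P n) := fun n i =>
    ((h n).law_signal i).aemeasurable.aestronglyMeasurable
  have m1 : ∀ n i, AEStronglyMeasurable (fun ω => postMean (πhat n ω) (X n i ω) (σhat n i ω))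
      (P n) := fun n i =>
    (aemeasurable_postMean_comp (hπhat n) ((h n).aemeasurable_obs i)
      (hσm n i)).aestronglyMeasurable
  have m2 : ∀ n i, AEStronglyMeasurable (fun ω => postMean (extendLaw μ₀) (X n i ω) (σ n i))
      (P n) := fun n i =>
    ((continuous_postMean_left μ₀ (hs n i)).measurable.comp_aemeasurable
      ((h n).aemeasurable_obs i)).aestronglyMeasurable
  have b0 : ∀ n i, ∀ᵐ ω ∂(P n), |θ n i ω| ≤ M := fun n i => by
    have h1 : ∀ᵐ ω ∂(P n), θ n i ω ∈ Set.Icc (-M) M :=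
      ae_of_ae_map ((h n).law_signal i).aemeasurable
        (((h n).law_signal i).map_eq ▸ ae_extendLaw μ₀)
    filter_upwards [h1] with ω hω using abs_le.2 hω
  have b1 : ∀ n i, ∀ᵐ ω ∂(P n), |postMean (πhat n ω) (X n i ω) (σhat n i ω)| ≤ M := fun n i => by
    filter_upwards [hσhat n, hsupp n] with ω h1 h2
    rw [← extendLaw_clampLaw hMM h2]
    exact abs_postMean_extendLaw_le _ _ (hc.trans_le (h1 i).1)
  have b2 : ∀ n i ω, |postMean (extendLaw μ₀) (X n i ω) (σ n i)| ≤ M := fun n i ω =>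
    abs_postMean_extendLaw_le _ _ (hs n i)
  have i1 : ∀ n i, MemLp (fun ω => θ n i ω - postMean (πhat n ω) (X n i ω) (σhat n i ω)) 2 (P n) :=
    fun n i => (MemLp.of_bound (mθ n i) M (b0 n i)).sub (MemLp.of_bound (m1 n i) M (b1 n i))
  have i2 : ∀ n i, MemLp (fun ω => θ n i ω - postMean (extendLaw μ₀) (X n i ω) (σ n i)) 2 (P n) :=
    fun n i => (MemLp.of_bound (mθ n i) M (b0 n i)).sub
      (MemLp.of_bound (m2 n i) M (Eventually.of_forall (b2 n i)))
  have i3 : ∀ n i, Integrable (fun ω => |postMean (πhat n ω) (X n i ω) (σhat n i ω) -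
        postMean (extendLaw μ₀) (X n i ω) (σ n i)|) (P n) := fun n i =>
    ((Integrable.of_bound (m1 n i) M (b1 n i)).sub
      (Integrable.of_bound (m2 n i) M (Eventually.of_forall (b2 n i)))).abs
  have hdev := tendsto_avg_integral_postMean hM hMM hc hσ h hσhat hsupp hvar hlim i3
  -- The oracle risk depends only on the law of `(θᵢ, εᵢ)`, so it can be computed on the model's own
  -- space, whatever the correlation between coordinates.
  have horacle : ∀ n i, oracleRisk (extendLaw μ₀) (σ n i) =
      ∫ ω, (θ n i ω - postMean (extendLaw μ₀) (X n i ω) (σ n i)) ^ 2 ∂(P n) := fun n i => by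
    have hcm := (continuous_postMean_left μ₀ (hs n i)).measurable
    rw [oracleRisk_extendLaw μ₀ (hs n i), ← ((h n).hasLaw_pair i).map_eq,
      integral_map ((h n).hasLaw_pair i).aemeasurable
        (by fun_prop : Measurable _).aestronglyMeasurable]
    simp_rw [(h n).obs]
  -- The difference of squares is `(p + q - 2θ)(p - q)`, with all three of `p`, `q`, `θ` bounded by
  -- `M`; hence the factor `4 M`.
  have hrisk : ∀ n, |(avg fun i => ∫ ω, (θ n i ω - postMean (πhat n ω) (X n i ω) (σhat n i ω)) ^ 2
      ∂(P n)) - avg fun i => oracleRisk (extendLaw μ₀) (σ n i)| ≤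
      4 * M * ∫ ω, avg (fun i => |postMean (πhat n ω) (X n i ω) (σhat n i ω) -
        postMean (extendLaw μ₀) (X n i ω) (σ n i)|) ∂(P n) := fun n => by
    rw [integral_avg (i3 n), ← avg_sub, ← avg_const_mul]
    refine (abs_avg_le _).trans (avg_mono fun i => ?_)
    rw [horacle, ← integral_sub (i1 n i).integrable_sq (i2 n i).integrable_sq,
      ← integral_const_mul, ← Real.norm_eq_abs]
    refine norm_integral_le_of_norm_le ((i3 n i).const_mul _) ?_
    filter_upwards [b0 n i, b1 n i] with ω h0 h1
    have h2 := b2 n i ω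
    set p := postMean (πhat n ω) (X n i ω) (σhat n i ω)
    set q := postMean (extendLaw μ₀) (X n i ω) (σ n i)
    have e : (θ n i ω - p) ^ 2 - (θ n i ω - q) ^ 2 = (p + q - 2 * θ n i ω) * (p - q) := by ring
    rw [Real.norm_eq_abs, e, abs_mul]
    refine mul_le_mul_of_nonneg_right ?_ (abs_nonneg _)
    rw [abs_le] at h0 h1 h2 ⊢
    constructor <;> linarith [h0.1, h0.2, h1.1, h1.2, h2.1, h2.2]
  have hbound : Tendsto (fun n => √(4 * M * ∫ ω, avg (fun i =>
      |postMean (πhat n ω) (X n i ω) (σhat n i ω) -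
        postMean (extendLaw μ₀) (X n i ω) (σ n i)|) ∂(P n))) atTop (𝓝 0) := by
    have h1 := hdev.const_mul (4 * M)
    rw [mul_zero] at h1
    have h2 := (Real.continuous_sqrt.tendsto 0).comp h1
    rw [Real.sqrt_zero] at h2
    exact h2
  refine squeeze_zero_norm (fun n => ?_) hbound
  rw [regret, Real.norm_eq_abs]
  refine (abs_sqrt_sub_sqrt_le (avg_nonneg fun i => integral_nonneg fun ω => sq_nonneg _)
    (avg_nonneg fun i => integral_nonneg fun p => sq_nonneg _)).trans
    (Real.sqrt_le_sqrt (hrisk n))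

end Regret

end NormalEB

theorem corollary1 {Ω : ℕ → Type*} [∀ n, MeasurableSpace (Ω n)]
    (P : ∀ n, Measure (Ω n)) [∀ n, IsProbabilityMeasure (P n)]
    (M : ℝ) (hM : 0 < M) (πstar : ProbabilityMeasure ℝ)
    (hπstar : NormalEB.SupportedIn M πstar)
    (Sig : ∀ n : ℕ, Matrix (Fin n) (Fin n) ℝ) (hSig : ∀ n, (Sig n).PosSemidef)
    (σ : ∀ n, Fin n → ℝ) (hσ : ∀ n i, 0 < σ n i) (hσSig : ∀ n i, Sig n i i = σ n i ^ 2)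
    (θ ε X : ∀ n, Fin n → Ω n → ℝ)
    (hθlaw : ∀ n i, HasLaw (θ n i) (πstar : Measure ℝ) (P n))
    (hθindep : ∀ n, iIndepFun (θ n) (P n))
    (hεlaw : ∀ n, HasLaw (fun ω => WithLp.toLp 2 (fun i => ε n i ω))
      (multivariateGaussian 0 (Sig n)) (P n))
    (hεθ : ∀ n, IndepFun (fun ω i => ε n i ω) (fun ω i => θ n i ω) (P n))
    (hX : ∀ n i ω, X n i ω = θ n i ω + ε n i ω)
    (πhat : ∀ n, Ω n → ProbabilityMeasure ℝ)
    (hπhat : ∀ n, Measurable (fun ω => (πhat n ω : Measure ℝ)))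
    (σhat : ∀ n, Fin n → Ω n → ℝ) (hσhat : ∀ n i, Measurable (σhat n i))
    (happ : NormalEB.ApproxOptimal P M πstar σ X πhat σhat)
    (hop : (fun n : ℕ => ‖Matrix.toEuclideanCLM (n := Fin n) (𝕜 := ℝ) (Sig n)‖)
      =o[atTop] (fun n : ℕ => (n : ℝ))) :
    NormalEB.TendstoInProb P πhat πstar
    ∧ NormalEB.TendstoInProb P
        (fun n ω => NormalEB.avg fun i => NormalEB.hellingerSq
          (NormalEB.mixDensity (πhat n ω) (σ n i)) (NormalEB.mixDensity πstar (σ n i))) 0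
    ∧ Tendsto (fun n => NormalEB.regret (P n) πstar (σ n) (θ n) (X n) (πhat n) (σhat n))
        atTop (𝓝 0) := by
  have hMM : -M ≤ M := by linarith
  obtain ⟨c, C, hc, hC0, hb⟩ := happ.bounds
  have hcC : c ≤ C := (hb 1 0).1.1.trans (hb 1 0).1.2
  have hσcC : ∀ n i, σ n i ∈ Set.Icc c C := fun n i => (hb n i).1
  have hσhatcC : ∀ n, ∀ᵐ ω ∂(P n), ∀ i, σhat n i ω ∈ Set.Icc c C := fun n =>
    ae_all_iff.2 fun i => (hb n i).2
  obtain ⟨μ₀, rfl⟩ : ∃ μ₀ : ProbabilityMeasure (Set.Icc (-M) M), NormalEB.extendLaw μ₀ = πstar :=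
    ⟨_, NormalEB.extendLaw_clampLaw hMM hπstar⟩
  have hmodel : ∀ n, NormalEB.IsCorrelatedModel (P n) (NormalEB.extendLaw μ₀) (Sig n) (σ n) (θ n)
      (ε n) (X n) := fun n =>
    ⟨hSig n, hσ n, hσSig n, hθlaw n, hθindep n, hεlaw n, hεθ n, hX n⟩
  have hlim := NormalEB.tendsto_clampLaw hM.le hMM hmodel hop happ
  refine ⟨?_, NormalEB.tendstoInProb_hellinger hMM hc hcC hσcC happ.supported hlim,
    NormalEB.tendsto_regret hM.le hMM hc hσcC hmodel hπhat hσhat hσhatcC happ.supported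
      happ.variances hlim⟩
  rw [NormalEB.tendstoInProb_iff]
  -- Consistency on `[-M, M]` transfers to the line by continuity of the push-forward; clamping
  -- changes nothing almost surely.
  refine ((NormalEB.continuous_extendLaw.tendsto μ₀).comp hlim).congr' ?_
  filter_upwards [NormalEB.eventually_probFilter_of_ae happ.supported] with z hz
  exact NormalEB.extendLaw_clampLaw hMM hz
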